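/- Let $n\ge 1$ be an integer and let $a,b$ be real with $b\neq 0$. Put $$F(v)=\frac{\zeta(a+iv)^n+\zeta(a+b-iv)^n}{\cosh(\pi v/b)},$$ and let $R_{n,1}$ be the residue of $F$ at $v=-ib/2$, $R_{n,2}$ the residue of $\zeta(a+iv)^n/\cosh(\pi v/b)$ at $v=i(a-1)$, and $R_{n,3}$ the residue of $\zeta(a+b-iv)^n/\cosh(\pi v/b)$ at $v=i(1-a-b)$. Let $H(a,b)=1$ if $b>0$ and $a<1<a+b$, or if $b<0$ and $a+b<1<a$ (that is, if the zeta poles lie inside the open strip between $\operatorname{Im}v=0$ and $\operatorname{Im}v=-b$); let $H(a,b)=\tfrac12$ if $a=1$ or $a+b=1$; and let $H(a,b)=0$ otherwise. Write $$C_n(a,b)=-i\pi\,\operatorname{sgn}(b)\,\bigl(R_{n,1}+(R_{n,2}+R_{n,3})\,H(a,b)\bigr).$$ 1. If $a\ne1$, $a+b\neq 1$ and $a+\frac b2\neq 1$, then $F$ is integrable on $\mathbb R$ and $\int_{-\infty}^{\infty}F(v)\,dv=C_n(a,b)$. If $a+\frac b2=1$, then $F$ is integrable on $\mathbb R$ and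 $\int_{-\infty}^\infty F(v)\,dv=\lim_{a'\to a,\,a'\ne a}C_n(a',b)$. If $n=1$ and ($a=1$ or $a+b=1$), then $F$ is integrable on $\{|v|>\varepsilon\}$ for each $\varepsilon>0$ and the principal value $\lim_{\varepsilon\to0^+}\int_{|v|>\varepsilon}F(v)\,dv$ equals $C_1(a,b)$. 2. If $a+\frac b2\ne1$, then $R_{n,1}=\frac{2ib}{\pi}\,\zeta(a+\tfrac b2)^n$. Put $A=\pi(a-1)/b$, let $\gamma$ be Euler's constant and $\gamma(j)$ the Stieltjes constants, $\zeta(s)=\frac1{s-1}+\sum_{j\ge0}\frac{(-1)^j}{j!}\gamma(j)(s-1)^j$. If $\cos A\neq0$, then $$R_{1,2}=R_{1,3}=-\frac{i}{\cos A},\qquad R_{2,2}=R_{2,3}=i\Bigl(-\frac{2\gamma}{\cos A}+\frac{\pi\sin A}{b\cos^2A}\Bigr),$$ $$R_{3,2}=R_{3,3}=i\Bigl(\frac{3\gamma(1)-3\gamma^2+\pi^2/(2b^2)}{\cos A}+\frac{3\pi\gamma\sin A}{b\cos^2A}-\frac{\pi^2}{b^2\cos^3A}\Bigr),$$ $$R_{4,2}=R_{4,3}=i\Bigl(\frac{12\gamma(1)\gamma-2\gamma(2)-4\gamma^3+2\gamma\pi^2/b^2}{\cos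 A}-\frac{\pi\sin A\,(-36\gamma^2b^2+24\gamma(1)b^2+\pi^2)}{6b^3\cos^2A}-\frac{4\pi^2\gamma}{b^2\cos^3A}+\frac{\pi^3\sin A}{b^3\cos^4A}\Bigr).$$ 3. If $H(a,b)=0$, then $F$ is integrable on $\mathbb R$ and $$\int_{-\infty}^{\infty}\frac{\zeta(a+iv)^n+\zeta(a+b-iv)^n}{\cosh(\pi v/b)}\,dv=2|b|\,\zeta\bigl(a+\tfrac b2\bigr)^n .$$ 4. If $a=-\frac b2$ and $0<|b|<2$, then $F$ is integrable on $\mathbb R$ and $$\int_{-\infty}^{\infty}\frac{\zeta(-\frac b2+iv)^n+\zeta(\frac b2-iv)^n}{\cosh(\pi v/b)}\,dv=2|b|\,\bigl(-\tfrac12\bigr)^n .$$ -/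

import Mathlib

open Complex MeasureTheory Filter Topology

/-- The residue at `z` of a function with an isolated singularity at `z`: the value of
`(2πi)⁻¹ ∮ f` over all sufficiently small positively oriented circles about `z`
(for an isolated singularity this integral is eventually constant as the radius tends to `0`). -/
noncomputable def complexResidue (f : ℂ → ℂ) (z : ℂ) : ℂ :=
  limUnder (𝓝[>] (0 : ℝ)) fun r : ℝ => (2 * (Real.pi : ℂ) * I)⁻¹ * ∮ w in C(z, r), f w

/-- The Stieltjes constant `γ(j)`, defined by
`ζ(s) = 1/(s-1) + ∑ (-1)^j γ(j) (s-1)^j / j!` about `s = 1`. The value of the entire function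
`ζ(s) - 1/(s-1)` at its removable singularity `s = 1` is Euler's constant. -/
noncomputable def stieltjesConst (j : ℕ) : ℂ :=
  (-1) ^ j * iteratedDeriv j
    (Function.update (fun s : ℂ => riemannZeta s - 1 / (s - 1)) 1
      (Real.eulerMascheroniConstant : ℂ)) 1

/-- First numerator term: `ζ(a + iv)^n / cosh(πv/b)`. -/
noncomputable def zetaTermLeft (n : ℕ) (a b : ℝ) (v : ℂ) : ℂ :=
  riemannZeta (a + I * v) ^ n / Complex.cosh (Real.pi * v / b)

/-- Second numerator term: `ζ(a + b - iv)^n / cosh(πv/b)`. -/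
noncomputable def zetaTermRight (n : ℕ) (a b : ℝ) (v : ℂ) : ℂ :=
  riemannZeta (a + b - I * v) ^ n / Complex.cosh (Real.pi * v / b)

/-- The integrand `(ζ(a + iv)^n + ζ(a + b - iv)^n) / cosh(πv/b)`. -/
noncomputable def zetaCoshIntegrand (n : ℕ) (a b : ℝ) (v : ℂ) : ℂ :=
  (riemannZeta (a + I * v) ^ n + riemannZeta (a + b - I * v) ^ n) /
    Complex.cosh (Real.pi * v / b)

/-- `R_{n,1}`: residue at the zero `v = -ib/2` of the denominator. -/
noncomputable def residueOne (n : ℕ) (a b : ℝ) : ℂ :=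
  complexResidue (zetaCoshIntegrand n a b) (-(I * b / 2))

/-- `R_{n,2}`: residue of the first term where `a + iv = 1`. -/
noncomputable def residueTwo (n : ℕ) (a b : ℝ) : ℂ :=
  complexResidue (zetaTermLeft n a b) (I * (a - 1))

/-- `R_{n,3}`: residue of the second term where `a + b - iv = 1`. -/
noncomputable def residueThree (n : ℕ) (a b : ℝ) : ℂ :=
  complexResidue (zetaTermRight n a b) (I * (1 - a - b))

open Classical in
/-- `H(a,b)`: `1` if the two zeta poles lie inside the strip between `Im v = -b` and `Im v = 0`,
`1/2` if they lie on its boundary, `0` otherwise. For `b < 0` the inequalities are reversed. -/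
noncomputable def poleWeight (a b : ℝ) : ℂ :=
  if (0 < b ∧ a < 1 ∧ 1 < a + b) ∨ (b < 0 ∧ 1 < a ∧ a + b < 1) then 1
  else if a = 1 ∨ a + b = 1 then 1 / 2
  else 0

/-- The closed form `-iπ sgn(b) (R_{n,1} + (R_{n,2} + R_{n,3}) H(a,b))`. -/
noncomputable def zetaCoshClosedForm (n : ℕ) (a b : ℝ) : ℂ :=
  -I * Real.pi * (Real.sign b : ℂ) *
    (residueOne n a b + (residueTwo n a b + residueThree n a b) * poleWeight a b)

/-! Put g(v) = ζ(a+iv)^n / cosh(πv/b). The reflection v ↦ -ib - v turns a+iv into a+b-iv and changes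
the sign of cosh(πv/b), so F(v) = g(v) - g(-ib-v). Hence ∫F is the difference of the integrals of g
along Im v = 0 and Im v = -b, which is -2πi sgn(b) times the sum of the residues of g between the
two lines. There cosh vanishes only at -ib/2, and ζ(a+iv) has its pole at i(a-1), which lies inside
exactly when H = 1. The same reflection gives R_{n,3} = R_{n,2} and makes R_{n,1} twice the residue
of g at -ib/2; this is how the factor 2πi becomes the iπ of the closed form.

Two analytic facts carry the argument. `integral_line_sub_integral_line` is a residue theorem for
strips, proved by subtracting principal parts whose line integrals are explicit.
`exists_norm_riemannZeta_le` is polynomial growth of ζ in vertical strips: the functional equation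
bounds ζ far to the left, the Dirichlet series bounds it to the right, and Phragmén–Lindelöf
interpolates, given an a priori exponential bound from the Mellin representation. The exponential
growth of cosh then supplies all the decay needed.

The remaining cases reduce to this one. If a+b/2 = 1, two poles merge inside the strip while the
line of integration stays regular, so continuity of the integral in a gives the limit. If n = 1 and
a = 1, write ζ(s) = 1/(s-1) + ζ₀(s) with ζ₀ entire: the ζ₀ part is a residue computation, the
singular kernel 1/(iv cosh(πv/b)) is odd and drops out of the principal value, and the remaining
kernel is a shift of it with integral sgn(b)(4-π). The case a+b = 1 is its mirror image. The
residues for n = 2, 3, 4 are coefficients of products of third-order Taylor jets. -/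

/-! ### Residues and principal parts at isolated singularities -/

/-- `f` has residue `c` at `z`: all sufficiently small circle integrals about `z` equal `2πi c`. -/
def HasResidue (f : ℂ → ℂ) (z c : ℂ) : Prop :=
  ∀ᶠ r : ℝ in 𝓝[>] 0, CircleIntegrable f z r ∧ ∮ w in C(z, r), f w = 2 * (Real.pi : ℂ) * I * c

lemma eventually_sphere_of_nhdsNE {z : ℂ} {p : ℂ → Prop} (h : ∀ᶠ w in 𝓝[≠] z, p w) :
    ∀ᶠ r : ℝ in 𝓝[>] 0, ∀ w ∈ Metric.sphere z r, p w := by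
  rw [eventually_nhdsWithin_iff, Metric.eventually_nhds_iff] at h
  obtain ⟨ε, hε, h⟩ := h
  filter_upwards [Ioo_mem_nhdsGT hε] with r hr w hw
  rw [mem_sphere_iff_norm] at hw
  refine h (by rw [dist_eq_norm, hw]; exact hr.2) ?_
  rintro rfl
  simp at hw
  exact hr.1.ne hw

lemma HasResidue.complexResidue_eq {f : ℂ → ℂ} {z c : ℂ} (h : HasResidue f z c) :
    complexResidue f z = c := by
  refine (tendsto_const_nhds.congr' ?_).limUnder_eq
  filter_upwards [h] with r hr
  rw [hr.2]
  field_simp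

lemma HasResidue.congr {f g : ℂ → ℂ} {z c : ℂ} (h : HasResidue f z c) (hfg : f =ᶠ[𝓝[≠] z] g) :
    HasResidue g z c := by
  filter_upwards [h, eventually_sphere_of_nhdsNE hfg, self_mem_nhdsWithin] with r hr he hpos
  have hpos' : (0 : ℝ) ≤ r := le_of_lt hpos
  refine ⟨?_, ?_⟩
  · refine hr.1.congr ?_
    exact fun θ _ => he _ (circleMap_mem_sphere z hpos' θ)
  · rw [← hr.2]
    exact (circleIntegral.integral_congr hpos' he).symm

lemma HasResidue.add {f g : ℂ → ℂ} {z c d : ℂ} (hf : HasResidue f z c) (hg : HasResidue g z d) :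
    HasResidue (fun w => f w + g w) z (c + d) := by
  filter_upwards [hf, hg] with r h1 h2
  exact ⟨h1.1.add h2.1, by rw [circleIntegral.integral_add h1.1 h2.1, h1.2, h2.2]; ring⟩

lemma HasResidue.const_mul {f : ℂ → ℂ} {z c : ℂ} (hf : HasResidue f z c) (a : ℂ) :
    HasResidue (fun w => a * f w) z (a * c) := by
  filter_upwards [hf] with r h1
  refine ⟨?_, by rw [circleIntegral.integral_const_mul, h1.2]; ring⟩
  exact h1.1.const_smul (a := a)

lemma HasResidue.neg {f : ℂ → ℂ} {z c : ℂ} (hf : HasResidue f z c) :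
    HasResidue (fun w => -f w) z (-c) := by
  simpa using hf.const_mul (-1)

lemma AnalyticAt.hasResidue {f : ℂ → ℂ} {z : ℂ} (hf : AnalyticAt ℂ f z) : HasResidue f z 0 := by
  obtain ⟨ε, hε, h⟩ := Metric.eventually_nhds_iff.1 hf.eventually_analyticAt
  filter_upwards [Ioo_mem_nhdsGT hε] with r hr
  have hd : ∀ w ∈ Metric.closedBall z r, DifferentiableAt ℂ f w := fun w hw =>
    (h (lt_of_le_of_lt hw hr.2)).differentiableAt
  have hc : ContinuousOn f (Metric.closedBall z r) := fun w hw =>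
    (hd w hw).continuousAt.continuousWithinAt
  refine ⟨(hc.mono Metric.sphere_subset_closedBall).circleIntegrable hr.1.le, ?_⟩
  rw [mul_zero]
  exact Complex.circleIntegral_eq_zero_of_differentiable_on_off_countable hr.1.le
    Set.countable_empty hc fun w hw => hd w (Metric.ball_subset_closedBall hw.1)

lemma hasResidue_inv_sub (z : ℂ) : HasResidue (fun w => (w - z)⁻¹) z 1 := by
  filter_upwards [self_mem_nhdsWithin] with r hr
  have hr : 0 < r := hr
  exact ⟨circleIntegrable_sub_inv_iff.2 (Or.inr (by simp [hr.ne, abs_of_pos hr])),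
    by rw [circleIntegral.integral_sub_center_inv _ hr.ne', mul_one]⟩

lemma hasResidue_inv_sub_pow (z : ℂ) {j : ℕ} (hj : j ≠ 1) :
    HasResidue (fun w => ((w - z) ^ j)⁻¹) z 0 := by
  filter_upwards [self_mem_nhdsWithin] with r hr
  have hr : 0 < r := hr
  have he : (fun w : ℂ => ((w - z) ^ j)⁻¹) = fun w => (w - z) ^ (-(j : ℤ)) := by
    ext w; simp
  rw [he]
  refine ⟨circleIntegrable_sub_zpow_iff.2 (Or.inr (Or.inr (by simp [hr.ne, abs_of_pos hr]))), ?_⟩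
  rw [circleIntegral.integral_sub_zpow_of_ne (by omega), mul_zero]

lemma HasResidue.sum {ι : Type*} (s : Finset ι) {f : ι → ℂ → ℂ} {z : ℂ} {c : ι → ℂ}
    (h : ∀ i ∈ s, HasResidue (f i) z (c i)) :
    HasResidue (fun w => ∑ i ∈ s, f i w) z (∑ i ∈ s, c i) := by
  classical
  induction s using Finset.induction_on with
  | empty => simpa using (analyticAt_const (v := (0 : ℂ)) (x := z)).hasResidue
  | insert i s hi ih =>
    simp only [Finset.sum_insert hi]
    exact (h i (Finset.mem_insert_self _ _)).add
      (ih fun j hj => h j (Finset.mem_insert_of_mem hj))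

/-- A function with a principal part of given coefficients has the first one as its residue. -/
lemma hasResidue_principalPart {z : ℂ} (N : ℕ) (c : ℕ → ℂ) {r : ℂ → ℂ} (hr : AnalyticAt ℂ r z) :
    HasResidue (fun w => (∑ k ∈ Finset.range (N + 1), c k * ((w - z) ^ (k + 1))⁻¹) + r w) z
      (c 0) := by
  have h : ∀ k ∈ Finset.range (N + 1), HasResidue (fun w => c k * ((w - z) ^ (k + 1))⁻¹) z
      (if k = 0 then c 0 else 0) := by
    intro k _
    rcases k with _ | k
    · simpa using (hasResidue_inv_sub z).const_mul (c 0)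
    · simpa using (hasResidue_inv_sub_pow z (j := k + 1 + 1) (by omega)).const_mul (c (k + 1))
  simpa using (HasResidue.sum _ h).add hr.hasResidue

lemma AnalyticAt.dslope_self {f : ℂ → ℂ} {z : ℂ} (hf : AnalyticAt ℂ f z) :
    AnalyticAt ℂ (dslope f z) z := by
  obtain ⟨p, hp⟩ := hf
  exact ⟨_, hp.has_fpower_series_dslope_fslope⟩

/-- Since g(w) = g(z) + (w-z)·`dslope g z w`, each step splits off the constant g(z) as the
coefficient of the highest remaining pole and lowers the order by one. -/
lemma AnalyticAt.exists_eq_sum_add {z : ℂ} (N : ℕ) :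
    ∀ {g : ℂ → ℂ}, AnalyticAt ℂ g z → ∃ (c : ℕ → ℂ) (r : ℂ → ℂ), AnalyticAt ℂ r z ∧
      ∀ w ≠ z, ((w - z) ^ N)⁻¹ * g w =
        (∑ k ∈ Finset.range N, c k * ((w - z) ^ (k + 1))⁻¹) + r w := by
  induction N with
  | zero => intro g hg; exact ⟨0, g, hg, by simp⟩
  | succ N ih =>
    intro g hg
    obtain ⟨c, r, hr, h⟩ := ih hg.dslope_self
    refine ⟨Function.update c N (g z), r, hr, fun w hw => ?_⟩
    have hw' : w - z ≠ 0 := sub_ne_zero.2 hw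
    rw [Finset.sum_range_succ, Function.update_self,
      Finset.sum_congr rfl (g := fun k => c k * ((w - z) ^ (k + 1))⁻¹), add_right_comm, ← h w hw]
    · have := sub_smul_dslope g z w
      rw [smul_eq_mul] at this
      have hg' : g w = (w - z) * dslope g z w + g z := by rw [this]; ring
      rw [hg']
      field_simp
      ring
    · intro k hk
      rw [Function.update_of_ne (by simp at hk; omega)]

/-- The principal part of a function meromorphic at a point. -/
lemma MeromorphicAt.exists_principalPart {f : ℂ → ℂ} {z : ℂ} (hf : MeromorphicAt f z) :
    ∃ (N : ℕ) (c : ℕ → ℂ) (r : ℂ → ℂ), AnalyticAt ℂ r z ∧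
      ∀ w ≠ z, f w = (∑ k ∈ Finset.range (N + 1), c k * ((w - z) ^ (k + 1))⁻¹) + r w := by
  obtain ⟨N, hN⟩ := hf
  -- The extra factor w - z raises the order to N + 1, so that the sum is never empty and always
  -- contains the coefficient `c 0` of the simple pole.
  obtain ⟨c, r, hr, h⟩ := AnalyticAt.exists_eq_sum_add (N + 1)
    (z := z) (g := fun w => (w - z) * ((w - z) ^ N • f w)) (by fun_prop)
  refine ⟨N, c, r, hr, fun w hw => ?_⟩
  have hw' : w - z ≠ 0 := sub_ne_zero.2 hw
  rw [← h w hw, smul_eq_mul]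
  field_simp
  ring

lemma HasResidue.unique {f : ℂ → ℂ} {z c d : ℂ} (h : HasResidue f z c) (h' : HasResidue f z d) :
    c = d := h.complexResidue_eq.symm.trans h'.complexResidue_eq

lemma MeromorphicAt.hasResidue {f : ℂ → ℂ} {z : ℂ} (hf : MeromorphicAt f z) :
    HasResidue f z (complexResidue f z) := by
  obtain ⟨N, c, r, hr, h⟩ := hf.exists_principalPart
  have := (hasResidue_principalPart N c hr).congr (g := f)
    (by filter_upwards [self_mem_nhdsWithin] with w hw using (h w hw).symm)
  rwa [this.complexResidue_eq]

/-- The residue at a simple pole. -/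
lemma AnalyticAt.hasResidue_div {g h : ℂ → ℂ} {z h' : ℂ} (hg : AnalyticAt ℂ g z)
    (hh : AnalyticAt ℂ h z) (h0 : h z = 0) (hd : HasDerivAt h h' z) (hne : h' ≠ 0) :
    HasResidue (fun w => g w / h w) z (g z / h') := by
  have hs : AnalyticAt ℂ (fun w => g w / dslope h z w) z :=
    hg.div hh.dslope_self (by rw [dslope_same, hd.deriv]; exact hne)
  have := (hasResidue_principalPart 0 (fun _ => g z / h') hs.dslope_self)
  refine this.congr ?_
  filter_upwards [self_mem_nhdsWithin] with w hw
  have hw' : w - z ≠ 0 := sub_ne_zero.2 hw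
  have e1 := sub_smul_dslope (fun w => g w / dslope h z w) z w
  have e2 := sub_smul_dslope h z w
  simp only [smul_eq_mul, dslope_same, hd.deriv, h0, sub_zero] at e1 e2
  rw [← e2]
  simp only [zero_add, Finset.range_one, Finset.sum_singleton, pow_one]
  rw [← mul_right_inj' hw', mul_add, e1]
  -- If the slope vanishes, division by zero makes both quotients by it zero and the identity still
  -- holds, so the neighbourhood need not be shrunk.
  by_cases hz : dslope h z w = 0
  · simp [hz]; field_simp; simp
  · field_simp
    ring

/-- A point reflection multiplies the coefficient of the pole of order k+1 by (-1)^(k+1), hence the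
residue by -1. Reading this off the principal part avoids a change of variables in circle integrals.
-/
lemma HasResidue.comp_const_sub {f : ℂ → ℂ} {z c : ℂ} (hf : HasResidue f z c) (d : ℂ)
    (hm : MeromorphicAt f z) : HasResidue (fun w => f (d - w)) (d - z) (-c) := by
  obtain ⟨N, e, r, hr, h⟩ := hm.exists_principalPart
  have h1 := (hasResidue_principalPart N e hr).congr (g := f)
    (by filter_upwards [self_mem_nhdsWithin] with w hw using (h w hw).symm)
  have hr' : AnalyticAt ℂ (fun w => r (d - w)) (d - z) :=
    AnalyticAt.comp (f := fun w => d - w) (by simpa using hr) (by fun_prop)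
  have h2 := hasResidue_principalPart N (fun k => (-1) ^ (k + 1) * e k) hr'
  rw [hf.unique h1]
  simp only [zero_add, pow_one, neg_mul, one_mul] at h2
  refine h2.congr ?_
  filter_upwards [self_mem_nhdsWithin] with w hw
  rw [h (d - w) (fun h => hw (by simp [← h]))]
  congr 1
  refine Finset.sum_congr rfl fun k _ => ?_
  rw [show d - w - z = (-1) * (w - (d - z)) by ring, mul_pow, mul_inv, ← inv_pow (-1 : ℂ),
    show ((-1 : ℂ))⁻¹ = -1 by norm_num]
  ring

/-! ### Horizontal strips: decay, shifting lines and the residue theorem -/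

/-- Quadratic decay at both ends of the horizontal strip `y₁ ≤ Im z ≤ y₂`. -/
def StripDecay (f : ℂ → ℂ) (y₁ y₂ : ℝ) : Prop :=
  ∃ C T : ℝ, 0 < T ∧ ∀ z : ℂ, y₁ ≤ z.im → z.im ≤ y₂ → T ≤ |z.re| → ‖f z‖ ≤ C / z.re ^ 2

lemma StripDecay.congr {f g : ℂ → ℂ} {y₁ y₂ T : ℝ} (h : StripDecay f y₁ y₂)
    (hfg : ∀ z : ℂ, T ≤ |z.re| → f z = g z) : StripDecay g y₁ y₂ := by
  obtain ⟨C, T', hT', h⟩ := h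
  refine ⟨C, max T T', lt_max_of_lt_right hT', fun z h1 h2 h3 => ?_⟩
  rw [← hfg z ((le_max_left _ _).trans h3)]
  exact h z h1 h2 ((le_max_right _ _).trans h3)

lemma StripDecay.add {f g : ℂ → ℂ} {y₁ y₂ : ℝ} (hf : StripDecay f y₁ y₂)
    (hg : StripDecay g y₁ y₂) : StripDecay (fun z => f z + g z) y₁ y₂ := by
  obtain ⟨C, T, hT, h⟩ := hf
  obtain ⟨C', T', hT', h'⟩ := hg
  refine ⟨C + C', max T T', lt_max_of_lt_left hT, fun z h1 h2 h3 => ?_⟩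
  rw [add_div]
  exact (norm_add_le _ _).trans (add_le_add (h z h1 h2 ((le_max_left _ _).trans h3))
    (h' z h1 h2 ((le_max_right _ _).trans h3)))

lemma StripDecay.const_mul {f : ℂ → ℂ} {y₁ y₂ : ℝ} (hf : StripDecay f y₁ y₂) (a : ℂ) :
    StripDecay (fun z => a * f z) y₁ y₂ := by
  obtain ⟨C, T, hT, h⟩ := hf
  refine ⟨‖a‖ * C, T, hT, fun z h1 h2 h3 => ?_⟩
  rw [norm_mul, mul_div_assoc]
  exact mul_le_mul_of_nonneg_left (h z h1 h2 h3) (norm_nonneg _)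

lemma StripDecay.sum {ι : Type*} (s : Finset ι) {f : ι → ℂ → ℂ} {y₁ y₂ : ℝ}
    (h : ∀ i ∈ s, StripDecay (f i) y₁ y₂) : StripDecay (fun z => ∑ i ∈ s, f i z) y₁ y₂ := by
  classical
  induction s using Finset.induction_on with
  | empty => exact ⟨0, 1, one_pos, by simp⟩
  | insert i s hi ih =>
    simp only [Finset.sum_insert hi]
    exact (h i (Finset.mem_insert_self _ _)).add
      (ih fun j hj => h j (Finset.mem_insert_of_mem hj))

/-- Merges a bound near the origin and quadratic decay beyond it into one integrable majorant. The
constant is explicit, so it can serve uniformly in a parameter under dominated convergence. -/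
lemma le_mul_inv_one_add_sq {C T B x y : ℝ} (hT : 0 < T) (hB0 : 0 ≤ B) (hC0 : 0 ≤ C)
    (h₁ : T ≤ |x| → y ≤ C / x ^ 2) (h₂ : |x| ≤ T → y ≤ B) :
    y ≤ (B * (1 + T ^ 2) + C * (1 + T ^ 2) / T ^ 2) * (1 + x ^ 2)⁻¹ := by
  have hx : 0 < 1 + x ^ 2 := by positivity
  rw [← div_eq_mul_inv, le_div_iff₀ hx]
  rcases le_total T |x| with hxT | hxT
  · have hTx : T ^ 2 ≤ x ^ 2 := by rw [← sq_abs x]; gcongr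
    have hx2 : 0 < x ^ 2 := lt_of_lt_of_le (by positivity) hTx
    have h1 := h₁ hxT
    have h2 : y * (1 + x ^ 2) ≤ C / x ^ 2 * (1 + x ^ 2) := by gcongr
    have h3 : C / x ^ 2 * (1 + x ^ 2) ≤ C * (1 + T ^ 2) / T ^ 2 := by
      rw [div_mul_eq_mul_div, div_le_div_iff₀ hx2 (by positivity)]
      nlinarith [mul_le_mul_of_nonneg_left hTx hC0]
    have h4 : 0 ≤ B * (1 + T ^ 2) := by positivity
    linarith
  · have h1 := h₂ hxT
    have hTx : x ^ 2 ≤ T ^ 2 := by rw [← sq_abs x]; gcongr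
    have h2 : y * (1 + x ^ 2) ≤ B * (1 + T ^ 2) := by gcongr
    have h4 : 0 ≤ C * (1 + T ^ 2) / T ^ 2 := by positivity
    linarith

/-- A continuous function on the line with quadratic decay is integrable. -/
lemma integrable_of_continuous_of_decay {f : ℝ → ℂ} (hf : Continuous f) {C T : ℝ} (hT : 0 < T)
    (h : ∀ x : ℝ, T ≤ |x| → ‖f x‖ ≤ C / x ^ 2) : Integrable f := by
  obtain ⟨B, hB⟩ := (isCompact_Icc (a := -T) (b := T)).exists_bound_of_continuousOn hf.continuousOn
  have hB0 : 0 ≤ B := (norm_nonneg _).trans (hB 0 ⟨by linarith, by linarith⟩)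
  have hC0 : 0 ≤ C := by
    have := (norm_nonneg _).trans (h T (le_abs_self T))
    by_contra hc
    have : C / T ^ 2 < 0 := div_neg_of_neg_of_pos (not_le.1 hc) (by positivity)
    linarith
  exact (integrable_inv_one_add_sq.const_mul _).mono' hf.aestronglyMeasurable
    (Eventually.of_forall fun x =>
      le_mul_inv_one_add_sq hT hB0 hC0 (h x) fun hx => hB x (abs_le.1 hx))

lemma StripDecay.integrable {f : ℂ → ℂ} {y₁ y₂ y : ℝ} (hf : StripDecay f y₁ y₂) (h₁ : y₁ ≤ y)
    (h₂ : y ≤ y₂) (hc : ∀ z : ℂ, z.im = y → ContinuousAt f z) :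
    Integrable fun x : ℝ => f (x + y * I) := by
  obtain ⟨C, T, hT, h⟩ := hf
  refine integrable_of_continuous_of_decay (C := C) (T := T) ?_ hT fun x hx => ?_
  · refine continuous_iff_continuousAt.2 fun x => ?_
    exact ContinuousAt.comp (f := fun x : ℝ => (x + y * I : ℂ)) (hc _ (by simp)) (by fun_prop)
  · simpa using h (x + y * I) (by simpa) (by simpa) (by simpa)

/-- The function `u` stands for R or -R, so both vertical sides of the growing rectangle are covered
at once. -/
lemma StripDecay.tendsto_side {f : ℂ → ℂ} {y₁ y₂ : ℝ} (hf : StripDecay f y₁ y₂) (hy : y₁ ≤ y₂)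
    {u : ℝ → ℝ} (hu : ∀ R, |u R| = |R|) :
    Tendsto (fun R : ℝ => ∫ y in y₁..y₂, f (u R + y * I)) atTop (𝓝 0) := by
  obtain ⟨C, T, hT, h⟩ := hf
  have h0 : Tendsto (fun R : ℝ => C / R ^ 2 * |y₂ - y₁|) atTop (𝓝 0) := by
    have : Tendsto (fun R : ℝ => C / R ^ 2) atTop (𝓝 0) :=
      tendsto_const_nhds.div_atTop (tendsto_pow_atTop two_ne_zero)
    simpa using this.mul_const |y₂ - y₁|
  refine squeeze_zero_norm' ?_ h0
  filter_upwards [eventually_ge_atTop T] with R hR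
  refine intervalIntegral.norm_integral_le_of_norm_le_const fun y hy' => ?_
  rw [Set.uIoc_of_le hy] at hy'
  have hR0 : 0 ≤ R := hT.le.trans hR
  have := h (u R + y * I) (by simpa using hy'.1.le) (by simpa using hy'.2)
    (by simpa [hu, abs_of_nonneg hR0] using hR)
  have e : (u R) ^ 2 = R ^ 2 := by rw [← sq_abs, hu, sq_abs]
  simpa [e] using this

/-- Moving the line of integration in a strip free of singularities. -/
lemma integral_line_eq_of_differentiable {f : ℂ → ℂ} {y₁ y₂ : ℝ} (hy : y₁ ≤ y₂)
    (hf : StripDecay f y₁ y₂)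
    (hd : ∀ z : ℂ, y₁ ≤ z.im → z.im ≤ y₂ → DifferentiableAt ℂ f z) :
    ∫ x : ℝ, f (x + y₁ * I) = ∫ x : ℝ, f (x + y₂ * I) := by
  have i1 : Integrable fun x : ℝ => f (x + y₁ * I) :=
    hf.integrable le_rfl hy fun z hz => (hd z hz.ge (hz.le.trans hy)).continuousAt
  have i2 : Integrable fun x : ℝ => f (x + y₂ * I) :=
    hf.integrable hy le_rfl fun z hz => (hd z (hy.trans hz.ge) hz.le).continuousAt
  have t1 := intervalIntegral_tendsto_integral i1 tendsto_neg_atTop_atBot tendsto_id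
  have t2 := intervalIntegral_tendsto_integral i2 tendsto_neg_atTop_atBot tendsto_id
  have t3 := (hf.tendsto_side hy (u := fun R => R) fun R => rfl).const_smul I
  have t4 := (hf.tendsto_side hy (u := fun R => -R) fun R => abs_neg R).const_smul I
  have key := ((t1.sub t2).add t3).sub t4
  have hz : ∀ R : ℝ, _ := fun R =>
    Complex.integral_boundary_rect_eq_zero_of_differentiableOn f ⟨-R, y₁⟩ ⟨R, y₂⟩ (by
      intro z hz
      rw [Complex.mem_reProdIm] at hz
      simp only [Set.uIcc_of_le hy] at hz
      exact (hd z hz.2.1 hz.2.2).differentiableWithinAt)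
  have := tendsto_nhds_unique (tendsto_const_nhds (x := (0 : ℂ)) (f := atTop (α := ℝ)))
    (key.congr hz)
  simp only [smul_zero, add_zero, sub_zero] at this
  exact (sub_eq_zero.1 this.symm)

lemma StripDecay.of_bound {f : ℂ → ℂ} {y₁ y₂ C T : ℝ} (hT : 0 < T)
    (h : ∀ z : ℂ, T ≤ |z.re| → ‖f z‖ ≤ C / z.re ^ 2) : StripDecay f y₁ y₂ :=
  ⟨C, T, hT, fun z _ _ hz => h z hz⟩

lemma half_abs_re_le_norm_sub {z w : ℂ} (h : 2 * |w.re| + 1 ≤ |z.re|) : |z.re| / 2 ≤ ‖z - w‖ := by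
  have h1 : |z.re - w.re| ≤ ‖z - w‖ := by simpa using abs_re_le_norm (z - w)
  have h2 : |z.re| - |w.re| ≤ |z.re - w.re| := abs_sub_abs_le_abs_sub _ _
  linarith

lemma stripDecay_inv_sub_pow (w : ℂ) (k : ℕ) (y₁ y₂ : ℝ) :
    StripDecay (fun z => ((z - w) ^ (k + 2))⁻¹) y₁ y₂ := by
  refine StripDecay.of_bound (C := 4) (T := 2 * |w.re| + 2) (by positivity) fun z hz => ?_
  have h1 := half_abs_re_le_norm_sub (z := z) (w := w) (by linarith)
  have h2 : 2 ≤ |z.re| := by linarith [abs_nonneg w.re]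
  have h3 : 1 ≤ ‖z - w‖ := by linarith
  rw [norm_inv, norm_pow, pow_add]
  have h4 : (|z.re| / 2) ^ 2 ≤ ‖z - w‖ ^ 2 := by gcongr
  have h5 : (|z.re| / 2) ^ 2 ≤ ‖z - w‖ ^ k * ‖z - w‖ ^ 2 :=
    h4.trans (le_mul_of_one_le_left (by positivity) (one_le_pow₀ h3))
  calc _ ≤ ((|z.re| / 2) ^ 2)⁻¹ := by gcongr
    _ = _ := by rw [div_pow, sq_abs]; field_simp; norm_num

/-- A single simple pole decays only like 1/|z| and is not integrable on a line; pairing it with an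
opposite pole at w' gains the missing power. -/
lemma stripDecay_inv_sub_sub_inv_sub (w w' : ℂ) (y₁ y₂ : ℝ) :
    StripDecay (fun z => (z - w)⁻¹ - (z - w')⁻¹) y₁ y₂ := by
  refine StripDecay.of_bound (C := 4 * ‖w - w'‖) (T := 2 * |w.re| + 2 * |w'.re| + 2)
    (by positivity) fun z hz => ?_
  have p1 := abs_nonneg w.re
  have p2 := abs_nonneg w'.re
  have h1 := half_abs_re_le_norm_sub (z := z) (w := w) (by linarith)
  have h1' := half_abs_re_le_norm_sub (z := z) (w := w') (by linarith)
  have h2 : 2 ≤ |z.re| := by linarith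
  have n1 : z - w ≠ 0 := norm_pos_iff.1 (by linarith)
  have n2 : z - w' ≠ 0 := norm_pos_iff.1 (by linarith)
  have e : (z - w)⁻¹ - (z - w')⁻¹ = (w - w') * ((z - w) * (z - w'))⁻¹ := by
    field_simp; ring
  rw [e, norm_mul, norm_inv, norm_mul]
  have h5 : (|z.re| / 2) * (|z.re| / 2) ≤ ‖z - w‖ * ‖z - w'‖ := by gcongr
  calc _ ≤ ‖w - w'‖ * ((|z.re| / 2) * (|z.re| / 2))⁻¹ := by gcongr
    _ = _ := by
      rw [div_mul_div_comm, ← sq, sq_abs]; field_simp; norm_num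

/-- Poles of order at least two have an antiderivative that vanishes at both ends of the line. -/
lemma integral_line_inv_sub_pow (w : ℂ) (k : ℕ) {y : ℝ} (hy : y ≠ w.im) :
    ∫ x : ℝ, ((x + y * I - w : ℂ) ^ (k + 2))⁻¹ = 0 := by
  have hne : ∀ z : ℂ, z.im = y → z - w ≠ 0 := fun z hz h => hy (by
    rw [← hz, sub_eq_zero.1 h])
  have hne' : ∀ x : ℝ, (x + y * I - w : ℂ) ≠ 0 := fun x => hne _ (by simp)
  have hi := (stripDecay_inv_sub_pow w k y y).integrable le_rfl le_rfl fun z hz => by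
    have := hne z hz
    fun_prop (disch := simpa)
  have hn : Tendsto (fun x : ℝ => ‖(x + y * I - w : ℂ)‖) (cocompact ℝ) atTop := by
    have h1 : Tendsto (fun x : ℝ => ‖(x : ℂ)‖ - ‖(w - y * I : ℂ)‖) (cocompact ℝ) atTop := by
      refine tendsto_atTop_add_const_right _ _ ?_
      exact (tendsto_norm_cocompact_atTop (E := ℝ)).congr fun x => by simp
    refine tendsto_atTop_mono (fun x => ?_) h1
    have := norm_sub_norm_le (x : ℂ) (w - y * I)
    rwa [show (x : ℂ) - (w - y * I) = x + y * I - w by ring] at this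
  have ht : Tendsto (fun x : ℝ => -(((k : ℂ) + 1)⁻¹) * ((x + y * I - w : ℂ) ^ (k + 1))⁻¹)
      (cocompact ℝ) (𝓝 0) := by
    have : Tendsto (fun x : ℝ => ((x + y * I - w : ℂ) ^ (k + 1))⁻¹) (cocompact ℝ) (𝓝 0) := by
      rw [tendsto_zero_iff_norm_tendsto_zero]
      simp only [norm_inv, norm_pow]
      exact tendsto_inv_atTop_zero.comp ((tendsto_pow_atTop (by omega)).comp hn)
    simpa using this.const_mul (-(((k : ℂ) + 1)⁻¹))
  have := integral_of_hasDerivAt_of_tendsto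
    (f := fun x : ℝ => -(((k : ℂ) + 1)⁻¹) * ((x + y * I - w : ℂ) ^ (k + 1))⁻¹) (fun x => ?_) hi
    (ht.mono_left atBot_le_cocompact) (ht.mono_left atTop_le_cocompact)
  · simpa using this
  · have h1 : HasDerivAt (fun x : ℝ => (x + y * I - w : ℂ)) 1 x :=
      ((Complex.ofRealCLM.hasDerivAt).add_const (y * I)).sub_const w
    have h2 := ((h1.pow (k + 1)).inv (pow_ne_zero _ (hne' x))).const_mul (-(((k : ℂ) + 1)⁻¹))
    refine h2.congr_deriv ?_
    have := hne' x
    have hk : (k : ℂ) + 1 ≠ 0 := by exact_mod_cast k.succ_ne_zero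
    simp
    field_simp
    ring

lemma integral_odd_eq_zero {f : ℝ → ℂ} (h : ∀ x, f (-x) = -f x) : ∫ x, f x = 0 := by
  have h1 := integral_neg_eq_self f volume
  simp only [h, integral_neg] at h1
  exact self_eq_neg.1 h1.symm

lemma integral_univ_div_sq_add_sq {α : ℝ} (hα : α ≠ 0) :
    Integrable (fun x : ℝ => α / (x ^ 2 + α ^ 2)) ∧
      ∫ x : ℝ, α / (x ^ 2 + α ^ 2) = Real.pi * Real.sign α := by
  have e : ∀ x : ℝ, α / (x ^ 2 + α ^ 2) = α⁻¹ * (1 + (α⁻¹ * x) ^ 2)⁻¹ := fun x => by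
    field_simp
    ring
  simp only [e]
  refine ⟨(integrable_inv_one_add_sq.comp_mul_left' (inv_ne_zero hα)).const_mul _, ?_⟩
  rw [integral_const_mul, Measure.integral_comp_mul_left (fun x => (1 + x ^ 2)⁻¹),
    integral_univ_inv_one_add_sq, inv_inv, smul_eq_mul]
  rcases hα.lt_or_gt with h | h
  · rw [Real.sign_of_neg h, abs_of_neg h]; field_simp
  · rw [Real.sign_of_pos h, abs_of_pos h]; field_simp

/-- Because both poles lie on one vertical line, a single translation centres them. The real parts
of the kernels are then odd and integrate to zero; the imaginary parts are Poisson kernels of mass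
±π, the sign telling on which side of the line the pole lies. -/
lemma integral_line_inv_sub_sub_inv_sub (w w' : ℂ) (hw : w'.re = w.re) {y : ℝ} (hy : y ≠ w.im)
    (hy' : y ≠ w'.im) :
    ∫ x : ℝ, ((x + y * I - w : ℂ)⁻¹ - (x + y * I - w')⁻¹) =
      -(Real.pi * I) * (Real.sign (y - w.im) - Real.sign (y - w'.im) : ℝ) := by
  have hα : y - w.im ≠ 0 := sub_ne_zero.2 hy
  have hβ : y - w'.im ≠ 0 := sub_ne_zero.2 hy'
  set α := y - w.im with hαd
  set β := y - w'.im with hβd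
  have e0 : ∀ (x γ : ℝ), γ ≠ 0 → (x + γ * I : ℂ)⁻¹ =
      ((x / (x ^ 2 + γ ^ 2) : ℝ) : ℂ) - ((γ / (x ^ 2 + γ ^ 2) : ℝ) : ℂ) * I := fun x γ hγ => by
    have h1 : (0 : ℝ) < x ^ 2 + γ ^ 2 := by positivity
    have h1' : ((x : ℂ) ^ 2 + (γ : ℂ) ^ 2) ≠ 0 := by exact_mod_cast h1.ne'
    rw [inv_eq_iff_eq_inv, eq_comm]
    refine inv_eq_of_mul_eq_one_left ?_
    push_cast
    field_simp
    ring_nf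
    simp
  have e1 : ∀ x : ℝ, ((x + w.re : ℝ) + y * I - w : ℂ)⁻¹ - ((x + w.re : ℝ) + y * I - w')⁻¹ =
      (((x / (x ^ 2 + α ^ 2) : ℝ) : ℂ) - ((x / (x ^ 2 + β ^ 2) : ℝ) : ℂ)) -
        (((α / (x ^ 2 + α ^ 2) - β / (x ^ 2 + β ^ 2) : ℝ) : ℂ)) * I := fun x => by
    have a1 : ((x + w.re : ℝ) + y * I - w : ℂ) = x + α * I := by
      apply Complex.ext <;> simp [hαd]
    have a2 : ((x + w.re : ℝ) + y * I - w' : ℂ) = x + β * I := by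
      apply Complex.ext <;> simp [hβd, hw]
    rw [a1, a2, e0 x α hα, e0 x β hβ]
    push_cast
    ring
  have hint : Integrable fun x : ℝ => ((x + y * I - w : ℂ)⁻¹ - (x + y * I - w')⁻¹) :=
    (stripDecay_inv_sub_sub_inv_sub w w' y y).integrable le_rfl le_rfl fun z hz => by
      have n1 : z - w ≠ 0 := fun h => hy (by rw [← hz, sub_eq_zero.1 h])
      have n2 : z - w' ≠ 0 := fun h => hy' (by rw [← hz, sub_eq_zero.1 h])
      fun_prop (disch := simpa)
  rw [← integral_add_right_eq_self _ w.re]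
  have hint' := hint.comp_add_right w.re
  simp only [e1] at hint' ⊢
  have hi2 : Integrable fun x : ℝ =>
      (((α / (x ^ 2 + α ^ 2) - β / (x ^ 2 + β ^ 2) : ℝ) : ℂ)) * I :=
    (((integral_univ_div_sq_add_sq hα).1.sub (integral_univ_div_sq_add_sq hβ).1).ofReal).mul_const I
  have hi1 := hint'.add hi2
  have hi1' : Integrable fun x : ℝ =>
      (((x / (x ^ 2 + α ^ 2) : ℝ) : ℂ) - ((x / (x ^ 2 + β ^ 2) : ℝ) : ℂ)) := by
    refine hi1.congr (Eventually.of_forall fun x => ?_)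
    simp
  rw [integral_sub hi1' hi2, integral_odd_eq_zero, integral_mul_const, integral_complex_ofReal,
    integral_sub (integral_univ_div_sq_add_sq hα).1 (integral_univ_div_sq_add_sq hβ).1,
    (integral_univ_div_sq_add_sq hα).2, (integral_univ_div_sq_add_sq hβ).2]
  · push_cast; ring
  · intro x
    push_cast
    ring

/-- **Residue theorem for a horizontal strip**. -/
theorem integral_line_sub_integral_line {y₁ y₂ : ℝ} (hy : y₁ ≤ y₂) (S : Finset ℂ) (ρ : ℂ → ℂ) :
    ∀ {f : ℂ → ℂ}, StripDecay f y₁ y₂ → (∀ z ∈ S, y₁ < z.im ∧ z.im < y₂) →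
      (∀ z ∈ S, MeromorphicAt f z) → (∀ z ∈ S, HasResidue f z (ρ z)) →
      (∀ z : ℂ, y₁ ≤ z.im → z.im ≤ y₂ → z ∉ S → DifferentiableAt ℂ f z) →
      (∫ x : ℝ, f (x + y₁ * I)) - ∫ x : ℝ, f (x + y₂ * I) =
        2 * Real.pi * I * ∑ z ∈ S, ρ z := by
  -- The induction keeps f general: the principal part at one pole is subtracted, which leaves the
  -- residues at the other poles unchanged.
  induction S using Finset.induction_on with
  | empty =>
    intro f hf _ _ _ hd
    rw [integral_line_eq_of_differentiable hy hf fun z h1 h2 => hd z h1 h2 (by simp)]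
    simp
  | insert w S hw ih =>
    intro f hf hS hm hr hd
    obtain ⟨N, c, r, hra, hfr⟩ := (hm w (Finset.mem_insert_self _ _)).exists_principalPart
    obtain ⟨hw1, hw2⟩ := hS w (Finset.mem_insert_self _ _)
    have hc0 : c 0 = ρ w := HasResidue.unique ((hasResidue_principalPart N c hra).congr
      (by filter_upwards [self_mem_nhdsWithin] with z hz using (hfr z hz).symm))
      (hr w (Finset.mem_insert_self _ _))
    -- an auxiliary pole above the strip
    let w' : ℂ := w + (y₂ - y₁ : ℝ) * I
    have hw're : w'.re = w.re := by simp [w']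
    have hw'im : y₂ < w'.im := by simp [w']; linarith
    let K : ℕ → ℂ → ℂ := fun k z => ((z - w) ^ (k + 2))⁻¹
    -- The principal part at w with its simple pole balanced at w', so that it decays. As w' lies
    -- above both lines, the balancing term contributes the same to each and cancels in the
    -- difference.
    let P : ℂ → ℂ := fun z => c 0 * ((z - w)⁻¹ - (z - w')⁻¹) +
      ∑ k ∈ Finset.range N, c (k + 1) * K k z
    have hPdiff : ∀ z : ℂ, z.im ≤ y₂ → z ≠ w → AnalyticAt ℂ P z := fun z hz hzw => by
      have n1 : z - w ≠ 0 := sub_ne_zero.2 hzw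
      have n2 : z - w' ≠ 0 := fun h => by
        rw [sub_eq_zero.1 h] at hz
        linarith
      refine AnalyticAt.add (by fun_prop (disch := simpa)) ?_
      refine Finset.analyticAt_fun_sum _ fun k _ => ?_
      simp only [K]
      fun_prop (disch := simpa using n1)
    have hfP : ∀ z ≠ w, f z - P z = r z + c 0 * (z - w')⁻¹ := fun z hz => by
      rw [hfr z hz, Finset.sum_range_succ']
      simp only [P, K, zero_add, pow_one]
      ring
    -- The value at w fills the removable singularity of f - P, making g analytic there.
    let g : ℂ → ℂ := Function.update (fun z => f z - P z) w (r w + c 0 * (w - w')⁻¹)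
    have hgne : ∀ z ≠ w, g z = f z - P z := fun z hz => Function.update_of_ne hz _ _
    have hgw : AnalyticAt ℂ g w := by
      have n2 : w - w' ≠ 0 := fun h => by
        rw [← sub_eq_zero.1 h] at hw'im
        linarith
      have : AnalyticAt ℂ (fun z => r z + c 0 * (z - w')⁻¹) w :=
        hra.add (by fun_prop (disch := simpa))
      refine this.congr (Eventually.of_forall fun z => ?_)
      by_cases hz : z = w
      · simp [g, hz]
      · rw [hgne z hz, hfP z hz]
    have hgev : ∀ z ≠ w, g =ᶠ[𝓝 z] fun z => f z - P z := fun z hz => by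
      filter_upwards [isOpen_ne.mem_nhds hz] with u hu using hgne u hu
    have hPdec : StripDecay P y₁ y₂ :=
      ((stripDecay_inv_sub_sub_inv_sub w w' y₁ y₂).const_mul _).add
        (StripDecay.sum _ fun k _ => (stripDecay_inv_sub_pow w k y₁ y₂).const_mul _)
    have hgdec : StripDecay g y₁ y₂ :=
      (hf.add (hPdec.const_mul (-1))).congr (T := |w.re| + 1) fun z hz => by
        have : z ≠ w := by rintro rfl; linarith
        rw [hgne z this]; ring
    have hint : ∀ y : ℝ, y₁ ≤ y → y ≤ y₂ → y ≠ w.im → (∀ z ∈ insert w S, z.im ≠ y) →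
        ∫ x : ℝ, g (x + y * I) = (∫ x : ℝ, f (x + y * I)) - ∫ x : ℝ, P (x + y * I) := by
      intro y h1 h2 h3 h4
      have hne : ∀ z : ℂ, z.im = y → z ≠ w := by rintro z hz rfl; exact h3 hz.symm
      rw [← integral_sub
        (hf.integrable h1 h2 fun z hz => (hd z (hz.ge.trans' h1) (hz.le.trans h2)
          fun h => h4 z h hz).continuousAt)
        (hPdec.integrable h1 h2 fun z hz => (hPdiff z (hz.le.trans h2) (hne z hz)).continuousAt)]
      exact integral_congr_ae (Eventually.of_forall fun x => hgne _ (hne _ (by simp)))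
    have hPint : ∀ y : ℝ, y₁ ≤ y → y ≤ y₂ → y ≠ w.im → ∫ x : ℝ, P (x + y * I) =
        c 0 * (-(Real.pi * I) * (Real.sign (y - w.im) - Real.sign (y - w'.im) : ℝ)) := by
      intro y h1 h2 h3
      have hne : ∀ z : ℂ, z.im = y → z - w ≠ 0 := by
        rintro z hz h; rw [sub_eq_zero.1 h] at hz; exact h3 hz.symm
      have hne' : ∀ z : ℂ, z.im = y → z - w' ≠ 0 := by
        rintro z hz h; rw [sub_eq_zero.1 h] at hz; linarith
      have hK : ∀ k ∈ Finset.range N, Integrable fun x : ℝ => c (k + 1) * K k (x + y * I) :=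
        fun k _ => ((stripDecay_inv_sub_pow w k y₁ y₂).integrable h1 h2 fun z hz => by
          have := hne z hz
          fun_prop (disch := simpa)).const_mul _
      rw [integral_add, integral_const_mul, integral_line_inv_sub_sub_inv_sub w w' hw're h3
        (by linarith), integral_finsetSum _ hK, Finset.sum_eq_zero, add_zero]
      · intro k _
        rw [integral_const_mul, integral_line_inv_sub_pow w k h3, mul_zero]
      · exact ((stripDecay_inv_sub_sub_inv_sub w w' y₁ y₂).integrable h1 h2 fun z hz => by
          have n1 := hne z hz
          have n2 := hne' z hz
          fun_prop (disch := simpa)).const_mul _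
      · exact integrable_finsetSum _ hK
    have hS' : ∀ z ∈ S, z ≠ w := by rintro z hz rfl; exact hw hz
    have hSim : ∀ z ∈ S, AnalyticAt ℂ P z := fun z hz =>
      hPdiff z (hS z (Finset.mem_insert_of_mem hz)).2.le (hS' z hz)
    have key := ih hgdec (fun z hz => hS z (Finset.mem_insert_of_mem hz))
      (fun z hz => ((hm z (Finset.mem_insert_of_mem hz)).sub (hSim z hz).meromorphicAt).congr
        ((hgev z (hS' z hz)).symm.filter_mono nhdsWithin_le_nhds))
      (fun z hz => by
        have := ((hr z (Finset.mem_insert_of_mem hz)).add (hSim z hz).neg.hasResidue)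
        rw [add_zero] at this
        exact this.congr (EventuallyEq.trans
          (Eventually.of_forall fun u => (sub_eq_add_neg (f u) (P u)).symm) <| (hgev z (hS' z hz)).symm.filter_mono nhdsWithin_le_nhds))
      (fun z h1 h2 hz => by
        by_cases hzw : z = w
        · rw [hzw]; exact hgw.differentiableAt
        · exact ((hd z h1 h2 (by simp [hzw, hz])).sub
            (hPdiff z h2 hzw).differentiableAt).congr_of_eventuallyEq (hgev z hzw))
    rw [hint y₁ le_rfl hy hw1.ne fun z hz => (hS z hz).1.ne',
      hint y₂ hy le_rfl hw2.ne' fun z hz => (hS z hz).2.ne,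
      hPint y₁ le_rfl hy hw1.ne, hPint y₂ hy le_rfl hw2.ne',
      Real.sign_of_neg (sub_neg.2 hw1), Real.sign_of_pos (sub_pos.2 hw2),
      Real.sign_of_neg (sub_neg.2 hw'im), Real.sign_of_neg (sub_neg.2 (hy.trans_lt hw'im)), hc0]
      at key
    rw [Finset.sum_insert hw, mul_add, ← key]
    push_cast
    ring

/-! ### Growth of the Gamma and zeta functions in vertical strips -/

lemma norm_Gamma_le {s : ℂ} (hs : 0 < s.re) : ‖Gamma s‖ ≤ Real.Gamma s.re := by
  rw [Complex.Gamma_eq_integral hs, Real.Gamma_eq_integral hs, Complex.GammaIntegral]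
  refine (norm_integral_le_integral_norm _).trans_eq ?_
  refine setIntegral_congr_fun measurableSet_Ioi fun x hx => ?_
  rw [norm_mul, Complex.norm_cpow_eq_rpow_re_of_pos hx, Complex.norm_real, Real.norm_eq_abs,
    abs_of_pos (Real.exp_pos _)]
  simp

/-- Each factor s + j of Γ(s+K)/Γ(s) has modulus at least |Im s| ≥ 1. This moves bounds to the
right, where Γ is dominated by its values on the real axis. -/
lemma norm_Gamma_le_norm_Gamma_add_nat {s : ℂ} (hs : 1 ≤ |s.im|) (K : ℕ) :
    ‖Gamma s‖ ≤ ‖Gamma (s + K)‖ := by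
  induction K with
  | zero => simp
  | succ K ih =>
    have h1 : 1 ≤ ‖s + K‖ := hs.trans (by simpa using abs_im_le_norm (s + K))
    rw [Nat.cast_succ, ← add_assoc, Complex.Gamma_add_one _ (norm_pos_iff.1 (by linarith)),
      norm_mul]
    exact ih.trans (le_mul_of_one_le_left (norm_nonneg _) h1)

lemma exists_norm_Gamma_le (x₁ x₂ : ℝ) :
    ∃ C : ℝ, ∀ s : ℂ, x₁ ≤ s.re → s.re ≤ x₂ → 1 ≤ |s.im| → ‖Gamma s‖ ≤ C := by
  obtain ⟨K, hK⟩ := exists_nat_ge (1 - x₁)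
  have hc : ContinuousOn Real.Gamma (Set.Icc 1 (x₂ + K)) := fun x hx =>
    (Real.differentiableAt_Gamma fun m => by
      have := hx.1
      have : (0 : ℝ) ≤ m := m.cast_nonneg
      intro h; linarith).continuousAt.continuousWithinAt
  obtain ⟨C, hC⟩ := isCompact_Icc.exists_bound_of_continuousOn hc
  refine ⟨C, fun s h1 h2 h3 => (norm_Gamma_le_norm_Gamma_add_nat h3 K).trans ?_⟩
  have hre : (s + K).re = s.re + K := by simp
  refine (norm_Gamma_le (by rw [hre]; linarith)).trans ?_
  rw [hre]
  exact (le_abs_self _).trans (hC _ ⟨by linarith, by linarith⟩)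

lemma norm_sin_le_exp_abs_im (z : ℂ) : ‖sin z‖ ≤ Real.exp |z.im| := by
  rw [Complex.sin, norm_div, norm_mul, norm_I, mul_one]
  have h1 : ‖cexp (-z * I)‖ ≤ Real.exp |z.im| := by
    rw [Complex.norm_exp]; simp; exact le_abs_self _
  have h2 : ‖cexp (z * I)‖ ≤ Real.exp |z.im| := by
    rw [Complex.norm_exp]; simp; exact neg_le_abs _
  have := (norm_sub_le (cexp (-z * I)) (cexp (z * I)))
  rw [show ‖(2 : ℂ)‖ = 2 by simp]
  linarith

lemma norm_cos_le_cosh_im (z : ℂ) : ‖cos z‖ ≤ Real.cosh z.im := by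
  rw [Complex.cos, norm_div, Real.cosh_eq]
  have h1 : ‖cexp (-z * I)‖ = Real.exp z.im := by rw [Complex.norm_exp]; simp
  have h2 : ‖cexp (z * I)‖ = Real.exp (-z.im) := by rw [Complex.norm_exp]; simp
  have := norm_add_le (cexp (z * I)) (cexp (-z * I))
  rw [show ‖(2 : ℂ)‖ = 2 by simp]
  linarith

/-- By the reflection formula 1/Γ(s) = Γ(1-s) sin(πs)/π, so an upper bound for Γ also gives one for
its reciprocal. -/
lemma exists_norm_Gamma_inv_le (x₁ x₂ : ℝ) :
    ∃ C : ℝ, 0 ≤ C ∧ ∀ s : ℂ, x₁ ≤ s.re → s.re ≤ x₂ → 1 ≤ |s.im| →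
      ‖(Gamma s)⁻¹‖ ≤ C * Real.exp (Real.pi * |s.im|) := by
  obtain ⟨C, hC⟩ := exists_norm_Gamma_le (1 - x₂) (1 - x₁)
  refine ⟨max C 0 , le_max_right _ _, fun s h1 h2 h3 => ?_⟩
  have him : s.im ≠ 0 := by intro h; norm_num [h] at h3
  have hG : Gamma s ≠ 0 := Complex.Gamma_ne_zero fun m h => him (by rw [h]; simp)
  have hpi : (Real.pi : ℂ) ≠ 0 := by exact_mod_cast Real.pi_ne_zero
  have hrefl := Complex.Gamma_mul_Gamma_one_sub s
  have hsin : sin (Real.pi * s) ≠ 0 := by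
    intro h
    rw [h, div_zero, mul_eq_zero] at hrefl
    exact hrefl.elim hG (Complex.Gamma_ne_zero fun m h => him (by
      have := congrArg im h; simpa using this))
  have e : (Gamma s)⁻¹ = Gamma (1 - s) * sin (Real.pi * s) / Real.pi := by
    have h4 : Gamma s * Gamma (1 - s) * sin (Real.pi * s) = Real.pi := by
      rw [hrefl, div_mul_cancel₀ _ hsin]
    rw [eq_div_iff hpi, inv_mul_eq_iff_eq_mul₀ hG, ← mul_assoc, h4]
  rw [e, norm_div, norm_mul]
  have b1 : ‖Gamma (1 - s)‖ ≤ max C 0 :=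
    (hC (1 - s) (by simp; linarith) (by simp; linarith) (by simpa using h3)).trans (le_max_left _ _)
  have b2 := norm_sin_le_exp_abs_im (Real.pi * s)
  have b3 : (Real.pi * s : ℂ).im = Real.pi * s.im := by simp
  rw [b3, abs_mul, abs_of_pos Real.pi_pos] at b2
  have b4 : (1 : ℝ) ≤ ‖(Real.pi : ℂ)‖ := by
    rw [Complex.norm_real, Real.norm_eq_abs, abs_of_pos Real.pi_pos]
    linarith [Real.pi_gt_three]
  exact (div_le_self (by positivity) b4).trans (mul_le_mul b1 b2 (norm_nonneg _) (le_max_right _ _))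

/-- On t ≤ 1 the weight t^(Re s - 1) is at most its value for Re s = x₁, on t ≥ 1 at most that for
x₂; the sum of the two endpoint integrands dominates throughout. -/
lemma exists_norm_mellin_le {f : ℝ → ℂ} (x₁ x₂ : ℝ) (h1 : MellinConvergent f x₁)
    (h2 : MellinConvergent f x₂) :
    ∃ C : ℝ, ∀ s : ℂ, x₁ ≤ s.re → s.re ≤ x₂ → ‖mellin f s‖ ≤ C := by
  refine ⟨∫ t in Set.Ioi (0 : ℝ), (‖(t : ℂ) ^ ((x₁ : ℂ) - 1) • f t‖ +
    ‖(t : ℂ) ^ ((x₂ : ℂ) - 1) • f t‖), fun s hs1 hs2 => ?_⟩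
  refine norm_integral_le_of_norm_le (h1.norm.add h2.norm) ?_
  refine (ae_restrict_iff' measurableSet_Ioi).2 (Eventually.of_forall fun t ht => ?_)
  have ht : 0 < t := ht
  simp only [norm_smul, Complex.norm_cpow_eq_rpow_re_of_pos ht, ← add_mul]
  gcongr
  simp only [sub_re, ofReal_re, one_re]
  rcases le_total t 1 with h | h
  · exact (Real.rpow_le_rpow_of_exponent_ge ht h (by linarith)).trans
      (le_add_of_nonneg_right (by positivity))
  · exact (Real.rpow_le_rpow_of_exponent_le h (by linarith)).trans
      (le_add_of_nonneg_left (by positivity))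

/-- Up to the factor 1/2 and the substitution s/2, this function is a Mellin transform that
converges for every s. -/
lemma exists_norm_completedRiemannZeta₀_le (x₁ x₂ : ℝ) :
    ∃ C : ℝ, ∀ s : ℂ, x₁ ≤ s.re → s.re ≤ x₂ → ‖completedRiemannZeta₀ s‖ ≤ C := by
  have hm := (HurwitzZeta.hurwitzEvenFEPair 0).isStrongFEPair_toStrongFEPair.hasMellin
  obtain ⟨C, hC⟩ := exists_norm_mellin_le (x₁ / 2) (x₂ / 2) (hm _).1 (hm _).1
  refine ⟨C / 2, fun s h1 h2 => ?_⟩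
  have e : (s / 2).re = s.re / 2 := by simp
  have := hC (s / 2) (by rw [e]; linarith) (by rw [e]; linarith)
  rw [completedRiemannZeta₀, HurwitzZeta.completedHurwitzZetaEven₀, norm_div,
    show ‖(2 : ℂ)‖ = 2 by simp]
  exact div_le_div_of_nonneg_right this zero_le_two

/-- A crude exponential bound for the zeta function in vertical strips. -/
lemma exists_norm_riemannZeta_le_exp (x₁ x₂ : ℝ) :
    ∃ C : ℝ, 0 ≤ C ∧ ∀ s : ℂ, x₁ ≤ s.re → s.re ≤ x₂ → 2 ≤ |s.im| →
      ‖riemannZeta s‖ ≤ C * Real.exp (Real.pi * |s.im|) := by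
  obtain ⟨C, hC⟩ := exists_norm_completedRiemannZeta₀_le x₁ x₂
  obtain ⟨D, hD0, hD⟩ := exists_norm_Gamma_inv_le (x₁ / 2) (x₂ / 2)
  refine ⟨(max C 0 + 1 + 1) * (Real.pi ^ (x₂ / 2) * D), by positivity, fun s h1 h2 h3 => ?_⟩
  have hs : 2 ≤ ‖s‖ := h3.trans (abs_im_le_norm s)
  have hs' : 2 ≤ ‖1 - s‖ := h3.trans (by simpa using abs_im_le_norm (1 - s))
  rw [riemannZeta_eq_completedRiemannZeta₀ (norm_pos_iff.1 (by linarith)), div_eq_mul_inv, norm_mul,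
    mul_inv, norm_mul, mul_assoc]
  have a1 : ‖completedRiemannZeta₀ s - 1 / s - 1 / (1 - s)‖ ≤ max C 0 + 1 + 1 := by
    have u1 : ‖1 / s‖ ≤ 1 := by
      rw [norm_div, norm_one]; exact (div_le_one (by linarith)).2 (by linarith)
    have u2 : ‖1 / (1 - s)‖ ≤ 1 := by
      rw [norm_div, norm_one]; exact (div_le_one (by linarith)).2 (by linarith)
    have u3 := (hC s h1 h2).trans (le_max_left C 0)
    exact (norm_sub_le _ _).trans (add_le_add ((norm_sub_le _ _).trans (add_le_add u3 u1)) u2)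
  have e1 : (s / 2).re = s.re / 2 := by simp
  have e2 : (s / 2).im = s.im / 2 := by simp
  have e3 : |s.im / 2| = |s.im| / 2 := by rw [abs_div, abs_two]
  have a2 := hD (s / 2) (by rw [e1]; linarith) (by rw [e1]; linarith) (by rw [e2, e3]; linarith)
  have a3 : ‖((Real.pi : ℂ) ^ (-s / 2))⁻¹‖ ≤ Real.pi ^ (x₂ / 2) := by
    rw [norm_inv, Complex.norm_cpow_eq_rpow_re_of_pos Real.pi_pos,
      ← Real.rpow_neg Real.pi_pos.le]
    refine Real.rpow_le_rpow_of_exponent_le (by linarith [Real.pi_gt_three]) ?_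
    simp; linarith
  have a4 : Real.exp (Real.pi * |(s / 2).im|) ≤ Real.exp (Real.pi * |s.im|) := by
    rw [e2, e3]
    refine Real.exp_le_exp.2 (mul_le_mul_of_nonneg_left ?_ Real.pi_pos.le)
    linarith [abs_nonneg s.im]
  calc _ ≤ (max C 0 + 1 + 1) * (Real.pi ^ (x₂ / 2) * (D * Real.exp (Real.pi * |s.im|))) := by
        gcongr
        exact a2.trans (mul_le_mul_of_nonneg_left a4 hD0)
    _ = _ := by ring

lemma exists_norm_riemannZeta_le_of_three_halves_le :
    ∃ B : ℝ, 0 ≤ B ∧ ∀ s : ℂ, 3 / 2 ≤ s.re → ‖riemannZeta s‖ ≤ B := by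
  have hsum : Summable fun n : ℕ => ((n : ℝ) + 1) ^ (-(3 / 2) : ℝ) := by
    have := (Real.summable_nat_rpow (p := -(3 / 2))).2 (by norm_num)
    simpa using (summable_nat_add_iff 1).2 this
  refine ⟨∑' n : ℕ, ((n : ℝ) + 1) ^ (-(3 / 2) : ℝ), tsum_nonneg fun n => by positivity,
    fun s hs => ?_⟩
  rw [zeta_eq_tsum_one_div_nat_add_one_cpow (by linarith)]
  refine tsum_of_norm_bounded hsum.hasSum fun n => ?_
  have e : ((n : ℂ) + 1) = ((n + 1 : ℝ) : ℂ) := by push_cast; rfl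
  rw [norm_div, norm_one, e, Complex.norm_cpow_eq_rpow_re_of_pos (by positivity), one_div,
    ← Real.rpow_neg (by positivity)]
  exact Real.rpow_le_rpow_of_exponent_le (by linarith [n.cast_nonneg (α := ℝ)]) (by linarith)

/-- On the critical line the reflection formula gives |Γ(s)|² = π / cosh(π Im s). This decay cancels
the growth of the cosine factor in the functional equation. -/
lemma norm_Gamma_half_mul_cosh_le {s : ℂ} (hs : s.re = 1 / 2) :
    ‖Gamma s‖ * Real.cosh (Real.pi * s.im / 2) ≤ 2 := by
  have h1 : 1 - s = (starRingEnd ℂ) s := by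
    apply Complex.ext <;> simp [hs]; norm_num
  have h2 := congrArg norm (Complex.Gamma_mul_Gamma_one_sub s)
  rw [h1, Complex.Gamma_conj, norm_mul, Complex.norm_conj, norm_div, Complex.norm_real,
    Real.norm_eq_abs, abs_of_pos Real.pi_pos] at h2
  have h3 : ‖sin (Real.pi * s)‖ = Real.cosh (Real.pi * s.im) := by
    have : (Real.pi * s : ℂ) = ((Real.pi * s.im : ℝ) : ℂ) * I + Real.pi / 2 := by
      apply Complex.ext
      · simp [hs]; ring
      · simp [hs]
    rw [this, Complex.sin_add_pi_div_two, Complex.cos_mul_I, ← Complex.ofReal_cosh,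
      Complex.norm_real, Real.norm_eq_abs, abs_of_pos (Real.cosh_pos _)]
  rw [h3] at h2
  set c := Real.cosh (Real.pi * s.im / 2) with hc
  have hc1 : 1 ≤ c := Real.one_le_cosh _
  have h4 : Real.cosh (Real.pi * s.im) = 2 * c ^ 2 - 1 := by
    have := Real.cosh_sq (Real.pi * s.im / 2)
    have h := Real.cosh_two_mul (Real.pi * s.im / 2)
    rw [show 2 * (Real.pi * s.im / 2) = Real.pi * s.im by ring] at h
    rw [h]; linarith
  have h5 : c ^ 2 ≤ Real.cosh (Real.pi * s.im) := by rw [h4]; nlinarith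
  have h6 : (‖Gamma s‖ * c) ^ 2 ≤ 2 ^ 2 := by
    have : ‖Gamma s‖ * ‖Gamma s‖ * Real.cosh (Real.pi * s.im) = Real.pi := by
      rw [h2]; field_simp [(Real.cosh_pos (Real.pi * s.im)).ne']
    calc _ = ‖Gamma s‖ * ‖Gamma s‖ * c ^ 2 := by ring
      _ ≤ ‖Gamma s‖ * ‖Gamma s‖ * Real.cosh (Real.pi * s.im) := by gcongr
      _ = Real.pi := this
      _ ≤ _ := by linarith [Real.pi_le_four]
  exact le_of_sq_le_sq h6 (by norm_num)

lemma norm_Gamma_add_nat_le {s : ℂ} (hs : s.re = 1 / 2) (k : ℕ) :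
    ‖Gamma (s + k)‖ ≤ (k + 1 + |s.im|) ^ k * ‖Gamma s‖ := by
  induction k with
  | zero => simp
  | succ k ih =>
    have h0 : s + k ≠ 0 := by
      intro h
      have := congrArg re h
      simp [hs] at this
      linarith [k.cast_nonneg (α := ℝ)]
    have h1 : ‖s + k‖ ≤ k + 1 + |s.im| := by
      refine (Complex.norm_le_abs_re_add_abs_im _).trans ?_
      simp only [add_re, natCast_re, add_im, natCast_im, add_zero, hs]
      rw [abs_of_pos (by positivity)]
      linarith
    rw [Nat.cast_succ, ← add_assoc, Complex.Gamma_add_one _ h0, norm_mul]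
    have h2 : (k : ℝ) + 1 + |s.im| ≤ k + 1 + 1 + |s.im| := by linarith
    calc _ ≤ (k + 1 + |s.im|) * ((k + 1 + |s.im|) ^ k * ‖Gamma s‖) := by gcongr
      _ = (k + 1 + |s.im|) ^ (k + 1) * ‖Gamma s‖ := by ring
      _ ≤ _ := by gcongr; omega

/-- Polynomial growth of the zeta function on the lines `Re s = 1/2 - k`. -/
lemma exists_norm_riemannZeta_le_of_re_eq {k : ℕ} (hk : 1 ≤ k) :
    ∃ C : ℝ, 0 ≤ C ∧ ∀ s : ℂ, s.re = 1 / 2 - k → ‖riemannZeta s‖ ≤ C * (k + 1 + |s.im|) ^ k := by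
  obtain ⟨B, hB0, hB⟩ := exists_norm_riemannZeta_le_of_three_halves_le
  have hk' : (1 : ℝ) ≤ k := by exact_mod_cast hk
  refine ⟨4 * B, by positivity, fun s hs => ?_⟩
  obtain ⟨w, rfl⟩ : ∃ w, s = 1 - w := ⟨1 - s, by ring⟩
  have hw : w.re = 1 / 2 + k := by simp at hs; linarith
  -- Shifting by k puts u on the critical line, where the modulus of Γ is known; the shift costs
  -- only a polynomial factor of degree k.
  obtain ⟨u, rfl⟩ : ∃ u, w = u + k := ⟨w - k, by ring⟩
  have hu : u.re = 1 / 2 := by simpa using hw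
  rw [riemannZeta_one_sub]
  · simp only [norm_mul]
    have b1 : ‖(2 * Real.pi : ℂ) ^ (-(u + k))‖ ≤ 1 := by
      have e : (2 * Real.pi : ℂ) = ((2 * Real.pi : ℝ) : ℂ) := by push_cast; rfl
      rw [e, Complex.norm_cpow_eq_rpow_re_of_pos (by positivity)]
      refine Real.rpow_le_one_of_one_le_of_nonpos (by linarith [Real.pi_gt_three]) ?_
      rw [neg_re, hw]; linarith
    have b2 := norm_Gamma_add_nat_le hu k
    have b3 : ‖cos (Real.pi * (u + k) / 2)‖ ≤ Real.cosh (Real.pi * u.im / 2) := by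
      refine (norm_cos_le_cosh_im _).trans_eq ?_
      congr 1
      simp
    have b4 := hB (u + k) (by rw [hw]; linarith)
    have b5 := norm_Gamma_half_mul_cosh_le hu
    have e : |(1 - (u + k)).im| = |u.im| := by simp
    rw [e, show ‖(2 : ℂ)‖ = 2 by simp]
    calc _ ≤ 2 * 1 * ((k + 1 + |u.im|) ^ k * ‖Gamma u‖) * Real.cosh (Real.pi * u.im / 2) * B := by
          gcongr
      _ = 2 * B * (k + 1 + |u.im|) ^ k * (‖Gamma u‖ * Real.cosh (Real.pi * u.im / 2)) := by ring
      _ ≤ 2 * B * (k + 1 + |u.im|) ^ k * 2 := by gcongr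
      _ = _ := by ring
  · intro n h
    have := congrArg re h
    rw [hw] at this
    simp at this
    linarith [n.cast_nonneg (α := ℝ)]
  · intro h
    have := congrArg re h
    rw [hw] at this
    simp at this
    linarith

lemma riemannZeta₁_eq {s : ℂ} (hs : s ≠ 1) : riemannZeta₁ s = (s - 1) * riemannZeta s := by
  rw [riemannZeta_eq_inv_sub_mul hs, mul_inv_cancel_left₀ (sub_ne_zero.2 hs)]

/-- Polynomial growth of `(s - 1) ζ(s)` in a vertical strip, by Phragmén–Lindelöf. -/
lemma exists_norm_riemannZeta₁_le {k : ℕ} (hk : 1 ≤ k) :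
    ∃ C : ℝ, 0 ≤ C ∧ ∀ s : ℂ, 1 / 2 - k ≤ s.re → s.re ≤ 3 / 2 →
      ‖riemannZeta₁ s‖ ≤ C * ‖s + (k + 1 : ℝ)‖ ^ (k + 1) := by
  obtain ⟨B, hB0, hB⟩ := exists_norm_riemannZeta_le_of_three_halves_le
  obtain ⟨D, hD0, hD⟩ := exists_norm_riemannZeta_le_of_re_eq hk
  obtain ⟨E, hE0, hE⟩ := exists_norm_riemannZeta_le_exp (1 / 2 - k) (3 / 2)
  have hk' : (1 : ℝ) ≤ k := by exact_mod_cast hk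
  -- The zero -M of the comparison polynomial (s+M)^(k+1) lies left of the strip, where consequently
  -- |s+M| ≥ 1. One power absorbs s - 1, the other k the growth of ζ on the left edge.
  set M : ℝ := k + 1 with hM
  have hM0 : 0 < M := by linarith
  have hz : ∀ s : ℂ, s.re ≠ 1 ∨ s.im ≠ 0 → riemannZeta₁ s = (s - 1) * riemannZeta s :=
    fun s hs => riemannZeta₁_eq (by rintro rfl; simp at hs)
  have hsM : ∀ s : ℂ, 1 / 2 - k ≤ s.re → 1 ≤ ‖s + M‖ := fun s hs => by
    have := re_le_norm (s + M)
    simp only [add_re, ofReal_re] at this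
    linarith
  have hs1 : ∀ s : ℂ, 1 / 2 - k ≤ s.re → ‖s - 1‖ ≤ (M + 2) * ‖s + M‖ := fun s hs => by
    have h1 : ‖s - 1‖ ≤ ‖s + M‖ + ‖((M + 1 : ℝ) : ℂ)‖ := by
      refine le_trans (le_of_eq ?_) (norm_sub_le _ _)
      congr 1; push_cast; ring
    rw [Complex.norm_real, Real.norm_eq_abs, abs_of_pos (by linarith)] at h1
    nlinarith [hsM s hs]
  have hne : ∀ s : ℂ, 1 / 2 - k ≤ s.re → (s + M) ^ (k + 1) ≠ 0 := fun s hs =>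
    pow_ne_zero _ (norm_pos_iff.1 (by linarith [hsM s hs]))
  set C : ℝ := B * (M + 2) + (M + 2) * D * (M + 1) ^ k with hC
  have hC0 : 0 ≤ C := by positivity
  refine ⟨C, hC0, fun s h1 h2 => ?_⟩
  have key : ‖riemannZeta₁ s / (s + M) ^ (k + 1)‖ ≤ C := by
    refine PhragmenLindelof.vertical_strip (a := 1 / 2 - k) (b := 3 / 2)
      (f := fun s => riemannZeta₁ s / (s + M) ^ (k + 1)) ?_ ?_ ?_ ?_ h1 h2
    · refine DifferentiableOn.diffContOnCl fun w hw => ?_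
      have hw' : w ∈ re ⁻¹' Set.Icc (1 / 2 - (k : ℝ)) (3 / 2) :=
        closure_minimal (Set.preimage_mono Set.Ioo_subset_Icc_self)
          (isClosed_Icc.preimage continuous_re) hw
      exact (DifferentiableAt.fun_div (c := riemannZeta₁) (d := fun s => (s + M) ^ (k + 1))
        (by fun_prop) (by fun_prop) (hne w hw'.1)).differentiableWithinAt
    · set L : ℝ := Real.pi / (3 / 2 - (1 / 2 - k)) with hL
      have hL0 : 0 < L := div_pos Real.pi_pos (by linarith)
      -- Phragmén–Lindelöf allows exp(B exp(c|Im s|)) for any c below L = π/width. The choice c =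
      -- L/2, B = (π+1)/c works because x ≤ exp x turns this into more than exp((π+1)|Im s|).
      refine ⟨L / 2, by linarith, (Real.pi + 1) / (L / 2), ?_⟩
      refine Asymptotics.IsBigO.of_bound ((k + 3) * E) ?_
      rw [eventually_inf_principal]
      filter_upwards [preimage_mem_comap (eventually_ge_atTop (2 : ℝ))] with w hw hwS
      have hw : 2 ≤ |w.im| := hw
      have hwS : 1 / 2 - (k : ℝ) < w.re ∧ w.re < 3 / 2 := hwS
      have him : w.im ≠ 0 := by intro h; norm_num [h] at hw
      rw [norm_div, norm_pow, hz w (Or.inr him), norm_mul]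
      have b1 := hE w hwS.1.le hwS.2.le hw
      have b2 : ‖w - 1‖ ≤ (k + 3) * Real.exp |w.im| := by
        refine (Complex.norm_le_abs_re_add_abs_im _).trans ?_
        have c1 : |(w - 1).re| ≤ k + 3 := by
          rw [sub_re, one_re, abs_le]; constructor <;> linarith
        have c2 : (w - 1).im = w.im := by simp
        rw [c2]
        have c3 := Real.add_one_le_exp |w.im|
        nlinarith [abs_nonneg w.im]
      have b3 : (1 : ℝ) ≤ ‖w + M‖ ^ (k + 1) := one_le_pow₀ (hsM w hwS.1.le)
      refine (div_le_self (by positivity) b3).trans ?_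
      rw [Real.norm_eq_abs, abs_of_pos (Real.exp_pos _)]
      calc _ ≤ ((k + 3) * Real.exp |w.im|) * (E * Real.exp (Real.pi * |w.im|)) := by gcongr
        _ = (k + 3) * E * Real.exp ((Real.pi + 1) * |w.im|) := by
          rw [add_mul Real.pi, Real.exp_add, one_mul]; ring
        _ ≤ _ := by
          refine mul_le_mul_of_nonneg_left (Real.exp_le_exp.2 ?_) (by positivity)
          rw [div_mul_eq_mul_div, le_div_iff₀ (by linarith), mul_assoc]
          refine mul_le_mul_of_nonneg_left ?_ (by linarith [Real.pi_pos])
          have := Real.add_one_le_exp (L / 2 * |w.im|)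
          linarith
    · intro w hw
      rw [norm_div, norm_pow, div_le_iff₀ (by have := hsM w hw.ge; positivity),
        hz w (Or.inl (by rw [hw]; linarith)), norm_mul]
      have c1 := hD w hw
      have c2 : (k : ℝ) + 1 + |w.im| ≤ (M + 1) * ‖w + M‖ := by
        have : |w.im| ≤ ‖w + M‖ := by simpa using abs_im_le_norm (w + M)
        nlinarith [hsM w hw.ge]
      calc _ ≤ ((M + 2) * ‖w + M‖) * (D * ((M + 1) * ‖w + M‖) ^ k) := by
            gcongr
            · exact hs1 w hw.ge
            · exact c1.trans (by gcongr)
        _ = (M + 2) * D * (M + 1) ^ k * ‖w + M‖ ^ (k + 1) := by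
          rw [mul_pow]; ring
        _ ≤ _ := by
          gcongr
          exact le_add_of_nonneg_left (by positivity)
    · intro w hw
      have hw' : 1 / 2 - (k : ℝ) ≤ w.re := by rw [hw]; linarith
      have hwM := hsM w hw'
      rw [norm_div, norm_pow, div_le_iff₀ (by positivity),
        hz w (Or.inl (by rw [hw]; norm_num)), norm_mul]
      calc _ ≤ ((M + 2) * ‖w + M‖) * B := by
            gcongr
            · exact hs1 w hw'
            · exact hB w hw.ge
        _ = B * (M + 2) * ‖w + M‖ := by ring
        _ ≤ B * (M + 2) * ‖w + M‖ ^ (k + 1) := by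
          gcongr
          exact le_self_pow₀ hwM (by omega)
        _ ≤ _ := by
          gcongr
          exact le_add_of_nonneg_right (by positivity)
  rwa [norm_div, norm_pow, div_le_iff₀ (by have := hsM s h1; positivity)] at key

/-- **Polynomial growth of the zeta function** in vertical strips. -/
theorem exists_norm_riemannZeta_le (x₁ x₂ : ℝ) :
    ∃ (C : ℝ) (p : ℕ), 0 ≤ C ∧ ∀ s : ℂ, x₁ ≤ s.re → s.re ≤ x₂ → 1 ≤ |s.im| →
      ‖riemannZeta s‖ ≤ C * |s.im| ^ p := by
  obtain ⟨B, hB0, hB⟩ := exists_norm_riemannZeta_le_of_three_halves_le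
  obtain ⟨k, hk⟩ := exists_nat_ge (max 1 (1 / 2 - x₁))
  have hk1 : (1 : ℝ) ≤ k := (le_max_left _ _).trans hk
  have hk2 : 1 / 2 - x₁ ≤ k := (le_max_right _ _).trans hk
  obtain ⟨C, hC0, hC⟩ := exists_norm_riemannZeta₁_le (k := k) (by exact_mod_cast hk1)
  refine ⟨B + C * (2 * k + 4) ^ (k + 1), k + 1, by positivity, fun s h1 h2 h3 => ?_⟩
  have him : s.im ≠ 0 := by intro h; norm_num [h] at h3
  have hp : (1 : ℝ) ≤ |s.im| ^ (k + 1) := one_le_pow₀ h3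
  rw [add_mul]
  rcases le_total (3 / 2) s.re with h | h
  · refine (hB s h).trans ((le_mul_of_one_le_right hB0 hp).trans ?_)
    exact le_add_of_nonneg_right (by positivity)
  · have hne : s ≠ 1 := by rintro rfl; simp at him
    have e := riemannZeta₁_eq hne
    have hs1 : 1 ≤ ‖s - 1‖ := h3.trans (by simpa using abs_im_le_norm (s - 1))
    have a1 : ‖riemannZeta s‖ ≤ ‖riemannZeta₁ s‖ := by
      rw [e, norm_mul]; exact le_mul_of_one_le_left (norm_nonneg _) hs1
    have a2 : ‖s + (k + 1 : ℝ)‖ ≤ (2 * k + 4) * |s.im| := by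
      refine (Complex.norm_le_abs_re_add_abs_im _).trans ?_
      have c1 : |(s + (k + 1 : ℝ)).re| ≤ 2 * k + 3 := by
        rw [add_re, ofReal_re, abs_le]; constructor <;> linarith
      have c2 : (s + (k + 1 : ℝ)).im = s.im := by simp
      rw [c2]
      nlinarith
    refine (a1.trans ((hC s (by linarith) h).trans ?_)).trans
      (le_add_of_nonneg_left (by positivity))
    rw [mul_assoc, ← mul_pow]
    gcongr

/-! ### Polynomial growth against the decay of 1/cosh -/

/-- Polynomial growth in every vertical strip, away from the real axis. -/
def PolynomialGrowth (h : ℂ → ℂ) : Prop :=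
  ∀ x₁ x₂ : ℝ, ∃ (C : ℝ) (p : ℕ), 0 ≤ C ∧ ∀ s : ℂ, x₁ ≤ s.re → s.re ≤ x₂ → 1 ≤ |s.im| →
    ‖h s‖ ≤ C * |s.im| ^ p

lemma polynomialGrowth_riemannZeta_pow (n : ℕ) :
    PolynomialGrowth fun s => riemannZeta s ^ n := by
  intro x₁ x₂
  obtain ⟨C, p, hC, h⟩ := exists_norm_riemannZeta_le x₁ x₂
  refine ⟨C ^ n, p * n, by positivity, fun s h1 h2 h3 => ?_⟩
  rw [norm_pow, pow_mul, ← mul_pow]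
  exact pow_le_pow_left₀ (norm_nonneg _) (h s h1 h2 h3) n

lemma norm_inv_sub_one_le {s : ℂ} (h : 1 ≤ |s.im|) : ‖(s - 1)⁻¹‖ ≤ 1 := by
  rw [norm_inv]
  exact inv_le_one_of_one_le₀ (h.trans (by simpa using abs_im_le_norm (s - 1)))

lemma polynomialGrowth_inv_sub_one : PolynomialGrowth fun s => (s - 1)⁻¹ :=
  fun _ _ => ⟨1, 0, zero_le_one, fun s _ _ h => by simpa using norm_inv_sub_one_le h⟩

lemma polynomialGrowth_riemannZeta₀ : PolynomialGrowth riemannZeta₀ := by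
  intro x₁ x₂
  obtain ⟨C, p, hC, h⟩ := exists_norm_riemannZeta_le x₁ x₂
  refine ⟨C + 1, p, by positivity, fun s h1 h2 h3 => ?_⟩
  have hs : s ≠ 1 := by rintro rfl; norm_num at h3
  have e : riemannZeta₀ s = riemannZeta s - (s - 1)⁻¹ := by simp [riemannZeta₀, hs]
  rw [e, add_mul]
  exact (norm_sub_le _ _).trans (add_le_add (h s h1 h2 h3)
    ((norm_inv_sub_one_le h3).trans (by rw [one_mul]; exact one_le_pow₀ h3)))

lemma exp_abs_re_div_four_le_norm_cosh {z : ℂ} (hz : 1 ≤ |z.re|) :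
    Real.exp |z.re| / 4 ≤ ‖cosh z‖ := by
  have key : ∀ x : ℝ, 1 ≤ x → Real.exp x / 4 ≤ (Real.exp x - Real.exp (-x)) / 2 := fun x hx => by
    have h1 := Real.add_one_le_exp x
    have h2 : Real.exp (-x) ≤ 1 := Real.exp_le_one_iff.2 (by linarith)
    linarith
  rw [Complex.cosh, norm_div, show ‖(2 : ℂ)‖ = 2 by simp]
  have n1 : ‖cexp z‖ = Real.exp z.re := Complex.norm_exp z
  have n2 : ‖cexp (-z)‖ = Real.exp (-z.re) := by rw [Complex.norm_exp]; simp
  have h1 : ‖cexp z‖ - ‖cexp (-z)‖ ≤ ‖cexp z + cexp (-z)‖ := by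
    simpa using norm_sub_norm_le (cexp z) (-cexp (-z))
  have h2 : ‖cexp (-z)‖ - ‖cexp z‖ ≤ ‖cexp z + cexp (-z)‖ := by
    rw [add_comm]
    simpa using norm_sub_norm_le (cexp (-z)) (-cexp z)
  rw [n1, n2] at h1 h2
  rcases abs_cases z.re with ⟨h, h'⟩ | ⟨h, h'⟩
  · rw [h] at hz ⊢
    refine (key _ hz).trans ?_
    gcongr
  · rw [h] at hz ⊢
    refine (key _ hz).trans ?_
    rw [neg_neg]
    gcongr

/-- The factor `1 / cosh (π z / b)` beats polynomial growth. -/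
lemma PolynomialGrowth.exists_norm_div_cosh_le {h : ℂ → ℂ} (hh : PolynomialGrowth h) {b : ℝ}
    (hb : b ≠ 0) (x₁ x₂ : ℝ) :
    ∃ C T : ℝ, 0 < T ∧ 0 ≤ C ∧ ∀ s z : ℂ, x₁ ≤ s.re → s.re ≤ x₂ → |s.im| = |z.re| → T ≤ |z.re| →
      ‖h s / cosh (Real.pi * z / b)‖ ≤ C / z.re ^ 2 := by
  obtain ⟨C, p, hC, hp⟩ := hh x₁ x₂
  set c : ℝ := Real.pi / |b| with hc
  have hc0 : 0 < c := div_pos Real.pi_pos (abs_pos.2 hb)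
  -- From |cosh| ≥ exp(x)/4 and exp(x) ≥ x^(p+2)/(p+2)! at x = c|Re z|: p powers absorb the growth
  -- and two remain. The threshold makes both |Re z| and c|Re z| at least 1.
  refine ⟨C * (4 * (p + 2).factorial / c ^ (p + 2)), max 1 (1 / c), by positivity, by positivity,
    fun s z h1 h2 h3 h4 => ?_⟩
  have hz1 : 1 ≤ |z.re| := (le_max_left _ _).trans h4
  have hz2 : 1 ≤ c * |z.re| := by
    have := (le_max_right _ _).trans h4
    rwa [div_le_iff₀' hc0] at this
  have hre : |(Real.pi * z / b : ℂ).re| = c * |z.re| := by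
    have : (Real.pi * z / b : ℂ).re = Real.pi * z.re / b := by
      rw [Complex.div_ofReal_re, Complex.re_ofReal_mul]
    rw [this, abs_div, abs_mul, abs_of_pos Real.pi_pos, hc]; ring
  have b1 := exp_abs_re_div_four_le_norm_cosh (z := Real.pi * z / b) (by rw [hre]; exact hz2)
  rw [hre] at b1
  have b2 := hp s h1 h2 (by rw [h3]; exact hz1)
  rw [h3] at b2
  have b3 := Real.pow_div_factorial_le_exp (x := c * |z.re|) (by positivity) (p + 2)
  have hzpos : 0 < |z.re| := by linarith
  have hf : (0 : ℝ) < (p + 2).factorial := by exact_mod_cast Nat.factorial_pos _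
  rw [norm_div]
  calc _ ≤ C * |z.re| ^ p / ((c * |z.re|) ^ (p + 2) / (p + 2).factorial / 4) := by
        gcongr
        exact (div_le_div_of_nonneg_right b3 (by norm_num)).trans b1
    _ = _ := by
      rw [← sq_abs z.re]
      field_simp
      ring

lemma PolynomialGrowth.stripDecay {h : ℂ → ℂ} (hh : PolynomialGrowth h) {b : ℝ} (hb : b ≠ 0)
    (a y₁ y₂ : ℝ) : StripDecay (fun v => h (a + I * v) / cosh (Real.pi * v / b)) y₁ y₂ := by
  obtain ⟨C, T, hT, _, h⟩ := hh.exists_norm_div_cosh_le hb (a - y₂) (a - y₁)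
  refine ⟨C, T, hT, fun z h1 h2 h3 => h _ z ?_ ?_ ?_ h3⟩
  · simp; linarith
  · simp; linarith
  · simp

/-! ### Zeros and reflection of the denominator; the integral as a residue sum -/

lemma eq_of_cosh_eq_zero {b : ℝ} (hb : b ≠ 0) {v : ℂ} (h : cosh (Real.pi * v / b) = 0) :
    ∃ k : ℤ, v = -(I * b * (2 * k + 1) / 2) := by
  rw [← Complex.cos_mul_I, Complex.cos_eq_zero_iff] at h
  obtain ⟨k, hk⟩ := h
  refine ⟨k, ?_⟩
  have hpi : (Real.pi : ℂ) ≠ 0 := by exact_mod_cast Real.pi_ne_zero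
  have hb' : (b : ℂ) ≠ 0 := by exact_mod_cast hb
  have h2 : v * I = b * (2 * k + 1) / 2 := by
    field_simp at hk
    field_simp
    linear_combination hk
  have : v = -(v * I * I) := by rw [mul_assoc, I_mul_I]; ring
  rw [this, h2]; ring

lemma im_eq_of_cosh_eq_zero {b : ℝ} (hb : b ≠ 0) {v : ℂ} (h : cosh (Real.pi * v / b) = 0) :
    ∃ k : ℤ, v = -(I * b * (2 * k + 1) / 2) ∧ v.im = -(b * (2 * k + 1) / 2) := by
  obtain ⟨k, hk⟩ := eq_of_cosh_eq_zero hb h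
  refine ⟨k, hk, ?_⟩
  have : v = ((-(b * (2 * k + 1) / 2) : ℝ) : ℂ) * I := by rw [hk]; push_cast; ring
  rw [this]; simp

/-- The only zero of `cosh (π v / b)` in the closed strip between `Im v = 0` and `Im v = -b`. -/
lemma eq_of_cosh_eq_zero_of_mem_strip {b : ℝ} (hb : b ≠ 0) {v : ℂ}
    (h : cosh (Real.pi * v / b) = 0) (h₁ : min 0 (-b) ≤ v.im) (h₂ : v.im ≤ max 0 (-b)) :
    v = -(I * b / 2) := by
  obtain ⟨k, hk, him⟩ := im_eq_of_cosh_eq_zero hb h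
  rw [him] at h₁ h₂
  have key : (0 : ℝ) ≤ 2 * k + 1 ∧ (2 * k + 1 : ℝ) ≤ 2 := by
    rcases hb.lt_or_gt with h | h
    · rw [min_eq_left (by linarith)] at h₁
      rw [max_eq_right (by linarith)] at h₂
      constructor <;> nlinarith
    · rw [min_eq_right (by linarith)] at h₁
      rw [max_eq_left (by linarith)] at h₂
      constructor <;> nlinarith
  have k0 : k = 0 := by
    have h1 : (0 : ℤ) ≤ 2 * k + 1 := by exact_mod_cast key.1
    have h2 : (2 * k + 1 : ℤ) ≤ 2 := by exact_mod_cast key.2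
    omega
  rw [hk, k0]; simp

/-- The symmetry behind the whole evaluation: reflection in -ib/2 exchanges the two boundary lines
of the strip and the two zeta arguments, and changes the sign of the denominator. -/
lemma cosh_reflect {b : ℝ} (hb : b ≠ 0) (v : ℂ) :
    cosh (Real.pi * (-(I * b) - v) / b) = -cosh (Real.pi * v / b) := by
  have hb' : (b : ℂ) ≠ 0 := by exact_mod_cast hb
  have : (Real.pi * (-(I * b) - v) / b : ℂ) = -(Real.pi * v / b + Real.pi * I) := by
    field_simp; ring
  rw [this, Complex.cosh_neg, Complex.cosh_add, Complex.cosh_mul_I, Complex.sinh_mul_I]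
  simp

/-- Evaluation of the symmetrised integral by residues in the strip between `Im v = 0` and
`Im v = -b`. -/
theorem PolynomialGrowth.integral_symm_div_cosh {h : ℂ → ℂ} (hh : PolynomialGrowth h) {b : ℝ}
    (hb : b ≠ 0) (a : ℝ) (S : Finset ℂ) (ρ : ℂ → ℂ)
    (hS : ∀ z ∈ S, min 0 (-b) < z.im ∧ z.im < max 0 (-b))
    (hm : ∀ z ∈ S, MeromorphicAt (fun v => h (a + I * v) / cosh (Real.pi * v / b)) z)
    (hr : ∀ z ∈ S, HasResidue (fun v => h (a + I * v) / cosh (Real.pi * v / b)) z (ρ z))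
    (hd : ∀ z : ℂ, min 0 (-b) ≤ z.im → z.im ≤ max 0 (-b) → z ∉ S →
      DifferentiableAt ℂ (fun v => h (a + I * v) / cosh (Real.pi * v / b)) z) :
    Integrable (fun v : ℝ => (h (a + I * v) + h (a + b - I * v)) / cosh (Real.pi * v / b)) ∧
      ∫ v : ℝ, (h (a + I * v) + h (a + b - I * v)) / cosh (Real.pi * v / b) =
        -(2 * Real.pi * I * (Real.sign b : ℂ)) * ∑ z ∈ S, ρ z := by
  set g : ℂ → ℂ := fun v => h (a + I * v) / cosh (Real.pi * v / b) with hg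
  have hdec : StripDecay g (min 0 (-b)) (max 0 (-b)) := hh.stripDecay hb a _ _
  have hline : ∀ y : ℝ, y = 0 ∨ y = -b → Integrable fun x : ℝ => g (x + y * I) := fun y hy => by
    have h1 : min 0 (-b) ≤ y := by rcases hy with rfl | rfl <;> simp
    have h2 : y ≤ max 0 (-b) := by rcases hy with rfl | rfl <;> simp
    have h3 : y = min 0 (-b) ∨ y = max 0 (-b) := by grind
    refine hdec.integrable h1 h2 fun z hz => (hd z (by rwa [hz]) (by rwa [hz]) ?_).continuousAt
    intro hzS
    have := hS z hzS
    rw [hz] at this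
    rcases h3 with h3 | h3
    · exact this.1.ne h3.symm
    · exact this.2.ne h3
  have i0 := hline 0 (Or.inl rfl)
  have ib := hline (-b) (Or.inr rfl)
  -- The second summand is minus the first one on the other boundary line, traversed backwards.
  have e : ∀ v : ℝ, (h (a + I * v) + h (a + b - I * v)) / cosh (Real.pi * v / b) =
      g (v + (0 : ℝ) * I) - g ((-v : ℝ) + (-b : ℝ) * I) := fun v => by
    have e1 : ((-v : ℝ) + (-b : ℝ) * I : ℂ) = -(I * b) - v := by push_cast; ring
    have e2 : (a + I * (-(I * b) - v) : ℂ) = a + b - I * v := by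
      linear_combination -(b : ℂ) * I_mul_I
    simp only [hg]
    rw [e1, cosh_reflect hb, e2]
    simp only [ofReal_zero, zero_mul, add_zero, div_neg, sub_neg_eq_add, add_div]
  have ib' : Integrable fun v : ℝ => g ((-v : ℝ) + (-b : ℝ) * I) := ib.comp_neg
  simp only [e]
  refine ⟨i0.sub ib', ?_⟩
  rw [integral_sub i0 ib', integral_neg_eq_self (fun v : ℝ => g (v + (-b : ℝ) * I)) volume]
  have key := integral_line_sub_integral_line (min_le_max (a := 0) (b := -b)) S ρ hdec hS hm hr hd
  rcases hb.lt_or_gt with hb0 | hb0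
  · rw [min_eq_left (by linarith), max_eq_right (by linarith)] at key
    rw [key, Real.sign_of_neg hb0]
    push_cast; ring
  · rw [min_eq_right (by linarith), max_eq_left (by linarith)] at key
    rw [← neg_sub, key, Real.sign_of_pos hb0]
    push_cast; ring

/-! ### The zeta integrand with no pole on the line of integration -/

lemma I_mul_I_mul_sub_one (a : ℝ) : (a + I * (I * (a - 1)) : ℂ) = 1 := by
  linear_combination ((a : ℂ) - 1) * I_mul_I

lemma eq_of_add_I_mul_eq_one {a : ℝ} {v : ℂ} (h : a + I * v = 1) : v = I * (a - 1) := by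
  linear_combination (-I) * h + v * I_mul_I

lemma analyticAt_riemannZeta {s : ℂ} (hs : s ≠ 1) : AnalyticAt ℂ riemannZeta s :=
  analyticOn_riemannZeta s hs

lemma analyticAt_cosh_mul_div (b : ℝ) (z : ℂ) :
    AnalyticAt ℂ (fun v : ℂ => cosh (Real.pi * v / b)) z := by
  have : Differentiable ℂ (fun v : ℂ => cosh (Real.pi * v / b)) := by
    simp only [div_eq_mul_inv]; fun_prop
  exact this.analyticAt z

lemma differentiableAt_zetaTermLeft {n : ℕ} {a b : ℝ} {z : ℂ} (h₁ : a + I * z ≠ 1)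
    (h₂ : cosh (Real.pi * z / b) ≠ 0) : DifferentiableAt ℂ (zetaTermLeft n a b) z := by
  refine DifferentiableAt.fun_div ?_ (analyticAt_cosh_mul_div b z).differentiableAt h₂
  exact ((differentiableAt_riemannZeta h₁).comp z (by fun_prop)).pow n

/-- Isolates the pole: `riemannZeta₁` is the entire function (s-1)ζ(s), so all of the zeta
singularity sits in the explicit power. -/
lemma zetaTermLeft_eq {n : ℕ} {a b : ℝ} {v : ℂ} (hv : v ≠ I * (a - 1)) :
    zetaTermLeft n a b v =
      ((I * (v - I * (a - 1))) ^ n)⁻¹ * (riemannZeta₁ (a + I * v) ^ n / cosh (Real.pi * v / b)) := by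
  have h1 : a + I * v ≠ 1 := fun h => hv (eq_of_add_I_mul_eq_one h)
  have h2 : (a + I * v - 1 : ℂ) = I * (v - I * (a - 1)) := by
    linear_combination ((a : ℂ) - 1) * I_mul_I
  rw [zetaTermLeft, riemannZeta_eq_inv_sub_mul h1, mul_pow, inv_pow, h2, mul_div_assoc]

lemma meromorphicAt_zetaTermLeft (n : ℕ) (a b : ℝ) (z : ℂ) :
    MeromorphicAt (zetaTermLeft n a b) z := by
  have h1 : AnalyticAt ℂ (fun v : ℂ => riemannZeta₁ (a + I * v) ^ n) z := by
    have : Differentiable ℂ (fun v : ℂ => riemannZeta₁ (a + I * v) ^ n) := by fun_prop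
    exact this.analyticAt z
  have h2 : MeromorphicAt (fun v : ℂ => ((I * (v - I * (a - 1))) ^ n)⁻¹ *
      (riemannZeta₁ (a + I * v) ^ n / cosh (Real.pi * v / b))) z :=
    (MeromorphicAt.fun_inv (by fun_prop)).fun_mul
      (h1.meromorphicAt.fun_div (analyticAt_cosh_mul_div b z).meromorphicAt)
  refine h2.congr ?_
  have : ∀ᶠ v in 𝓝[≠] z, v ≠ I * (a - 1) := by
    by_cases hz : z = I * (a - 1)
    · rw [hz]; exact self_mem_nhdsWithin
    · exact nhdsWithin_le_nhds (isOpen_ne.mem_nhds hz)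
  filter_upwards [this] with v hv using (zetaTermLeft_eq hv).symm

lemma zetaTermRight_eq {n : ℕ} {a b : ℝ} (hb : b ≠ 0) (v : ℂ) :
    zetaTermRight n a b v = -zetaTermLeft n a b (-(I * b) - v) := by
  have e2 : (a + I * (-(I * b) - v) : ℂ) = a + b - I * v := by
    linear_combination -(b : ℂ) * I_mul_I
  rw [zetaTermLeft, zetaTermRight, cosh_reflect hb, e2, div_neg, neg_neg]

lemma zetaCoshIntegrand_eq {n : ℕ} {a b : ℝ} (hb : b ≠ 0) (v : ℂ) :
    zetaCoshIntegrand n a b v = zetaTermLeft n a b v + -zetaTermLeft n a b (-(I * b) - v) := by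
  rw [← zetaTermRight_eq hb, zetaTermLeft, zetaTermRight, zetaCoshIntegrand, add_div]

/-- The reflection carries one zeta pole to the other; its sign change of the residue cancels the
sign change of cosh. -/
lemma residueThree_eq_residueTwo (n : ℕ) (a : ℝ) {b : ℝ} (hb : b ≠ 0) :
    residueThree n a b = residueTwo n a b := by
  have hm := meromorphicAt_zetaTermLeft n a b (I * (a - 1))
  have h := (hm.hasResidue.comp_const_sub (-(I * b)) hm).neg
  rw [neg_neg, show (-(I * b) - I * (a - 1) : ℂ) = I * (1 - a - b) by ring] at h
  simp only [← zetaTermRight_eq hb] at h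
  exact h.complexResidue_eq

/-- The point -ib/2 is fixed by the reflection, so both terms of the integrand contribute the same
residue there, even if a zeta pole falls on it. -/
lemma residueOne_eq_two_mul (n : ℕ) (a : ℝ) {b : ℝ} (hb : b ≠ 0) :
    residueOne n a b = 2 * complexResidue (zetaTermLeft n a b) (-(I * b / 2)) := by
  have hm := meromorphicAt_zetaTermLeft n a b (-(I * b / 2))
  have h := (hm.hasResidue.comp_const_sub (-(I * b)) hm).neg
  rw [neg_neg, show (-(I * b) - -(I * b / 2) : ℂ) = -(I * b / 2) by ring] at h
  have h2 := hm.hasResidue.add h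
  simp only [← zetaCoshIntegrand_eq hb] at h2
  rw [residueOne, h2.complexResidue_eq, two_mul]

lemma cosh_half_period {b : ℝ} (hb : b ≠ 0) : cosh (Real.pi * (-(I * b / 2)) / b) = 0 := by
  have hb' : (b : ℂ) ≠ 0 := by exact_mod_cast hb
  have : (Real.pi * (-(I * b / 2)) / b : ℂ) = -((Real.pi / 2 : ℂ) * I) := by field_simp
  rw [this, Complex.cosh_neg, Complex.cosh_mul_I, Complex.cos_pi_div_two]

lemma hasDerivAt_cosh_mul_div (b : ℝ) (z : ℂ) :
    HasDerivAt (fun v : ℂ => cosh (Real.pi * v / b))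
      (Real.pi / b * sinh (Real.pi * z / b)) z := by
  have h : HasDerivAt (fun v : ℂ => (Real.pi * v / b : ℂ)) (Real.pi / b) z := by
    simpa using ((hasDerivAt_id z).const_mul (Real.pi : ℂ)).div_const (b : ℂ)
  simpa [mul_comm] using h.ccosh

lemma hasDerivAt_cosh_half_period {b : ℝ} (hb : b ≠ 0) :
    HasDerivAt (fun v : ℂ => cosh (Real.pi * v / b)) (-(Real.pi / b * I)) (-(I * b / 2)) := by
  have hb' : (b : ℂ) ≠ 0 := by exact_mod_cast hb
  refine (hasDerivAt_cosh_mul_div b _).congr_deriv ?_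
  have : (Real.pi * (-(I * b / 2)) / b : ℂ) = -((Real.pi / 2 : ℂ) * I) := by field_simp
  rw [this, Complex.sinh_neg, Complex.sinh_mul_I, Complex.sin_pi_div_two]
  ring

/-- The residue of `h(a + iv) / cosh (π v / b)` at the zero `v = -ib/2` of the denominator. -/
lemma hasResidue_div_cosh_half_period {h : ℂ → ℂ} (a : ℝ) {b : ℝ} (hb : b ≠ 0)
    (hh : AnalyticAt ℂ h (a + b / 2)) :
    HasResidue (fun v => h (a + I * v) / cosh (Real.pi * v / b)) (-(I * b / 2))
      (I * b / Real.pi * h (a + b / 2)) := by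
  have hb' : (b : ℂ) ≠ 0 := by exact_mod_cast hb
  have hpi : (Real.pi : ℂ) ≠ 0 := by exact_mod_cast Real.pi_ne_zero
  have e : (a + I * (-(I * b / 2)) : ℂ) = a + b / 2 := by
    linear_combination -(b / 2 : ℂ) * I_mul_I
  have hg : AnalyticAt ℂ (fun v => h (a + I * v)) (-(I * b / 2)) :=
    AnalyticAt.comp (f := fun v => (a + I * v : ℂ)) (by rwa [e]) (by fun_prop)
  have := hg.hasResidue_div (analyticAt_cosh_mul_div b _) (cosh_half_period hb)
    (hasDerivAt_cosh_half_period hb) (by simp [hb])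
  rw [e] at this
  convert this using 1
  generalize h (a + b / 2) = w
  field_simp
  linear_combination w * I_mul_I

lemma complexResidue_zetaTermLeft (n : ℕ) {a b : ℝ} (hb : b ≠ 0) (h : a + b / 2 ≠ 1) :
    complexResidue (zetaTermLeft n a b) (-(I * b / 2)) =
      I * b / Real.pi * riemannZeta (a + b / 2) ^ n :=
  (hasResidue_div_cosh_half_period (h := fun s => riemannZeta s ^ n) a hb
    ((analyticAt_riemannZeta (by exact_mod_cast h)).pow n)).complexResidue_eq

lemma residueOne_eq (n : ℕ) {a b : ℝ} (hb : b ≠ 0) (h : a + b / 2 ≠ 1) :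
    residueOne n a b = 2 * I * b / Real.pi * riemannZeta (a + b / 2) ^ n := by
  rw [residueOne_eq_two_mul n a hb, complexResidue_zetaTermLeft n hb h]
  ring

lemma half_period_mem_strip {b : ℝ} (hb : b ≠ 0) :
    min 0 (-b) < (-(I * b / 2) : ℂ).im ∧ (-(I * b / 2) : ℂ).im < max 0 (-b) := by
  have : (-(I * b / 2) : ℂ) = ((-(b / 2) : ℝ) : ℂ) * I := by push_cast; ring
  rw [this]
  simp
  rcases hb.lt_or_gt with h | h
  · exact ⟨Or.inl (by linarith), Or.inr (by linarith)⟩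
  · exact ⟨Or.inr (by linarith), Or.inl (by linarith)⟩

lemma im_I_mul_sub_one (a : ℝ) : (I * (a - 1) : ℂ).im = a - 1 := by simp

open Classical in
/-- The integral when no pole of the zeta factors lies on the line of integration and the poles
do not coalesce. -/
theorem integral_zetaCoshIntegrand (n : ℕ) {a b : ℝ} (hb : b ≠ 0) (h₁ : a ≠ 1) (h₂ : a + b ≠ 1)
    (h₃ : a + b / 2 ≠ 1) :
    Integrable (fun v : ℝ => zetaCoshIntegrand n a b v) ∧
      ∫ v : ℝ, zetaCoshIntegrand n a b v = zetaCoshClosedForm n a b := by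
  let H : Prop := (0 < b ∧ a < 1 ∧ 1 < a + b) ∨ (b < 0 ∧ 1 < a ∧ a + b < 1)
  have hw : poleWeight a b = if H then 1 else 0 := by
    simp only [poleWeight, H]
    rw [if_neg (c := a = 1 ∨ a + b = 1) (by tauto)]
  -- Only the first zeta term is integrated round the strip, so at most one zeta pole is listed.
  let S : Finset ℂ := if H then {-(I * b / 2), I * (a - 1)} else {-(I * b / 2)}
  have hne : (-(I * b / 2) : ℂ) ≠ I * (a - 1) := fun h => h₃ (by
    have e : (-(I * b / 2) : ℂ) = ((-(b / 2) : ℝ) : ℂ) * I := by push_cast; ring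
    have := congrArg im h
    rw [im_I_mul_sub_one, e] at this
    simp at this
    linarith)
  have hstrip : H ↔ min 0 (-b) < a - 1 ∧ a - 1 < max 0 (-b) := by
    simp only [H, min_lt_iff, lt_max_iff]
    grind
  have key := (polynomialGrowth_riemannZeta_pow n).integral_symm_div_cosh hb a S
    (complexResidue (zetaTermLeft n a b)) (fun z hz => ?_)
    (fun z _ => meromorphicAt_zetaTermLeft n a b z)
    (fun z _ => (meromorphicAt_zetaTermLeft n a b z).hasResidue)
    (fun z hz1 hz2 hzS => ?_)
  · refine ⟨key.1, key.2.trans ?_⟩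
    rw [zetaCoshClosedForm, residueThree_eq_residueTwo n a hb, residueOne_eq_two_mul n a hb, hw]
    by_cases hH : H
    · simp only [S, if_pos hH, Finset.sum_pair hne, residueTwo]
      ring
    · simp only [S, if_neg hH, Finset.sum_singleton]
      ring
  · by_cases hH : H
    · simp only [S, if_pos hH, Finset.mem_insert, Finset.mem_singleton] at hz
      rcases hz with rfl | rfl
      · exact half_period_mem_strip hb
      · rw [im_I_mul_sub_one]; exact hstrip.1 hH
    · simp only [S, if_neg hH, Finset.mem_singleton] at hz
      rw [hz]; exact half_period_mem_strip hb
  · have hz0 : z ≠ -(I * b / 2) := by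
      rintro rfl
      refine hzS ?_
      by_cases hH : H <;> simp [S, hH]
    refine differentiableAt_zetaTermLeft (fun h => ?_)
      fun h => hz0 (eq_of_cosh_eq_zero_of_mem_strip hb h hz1 hz2)
    obtain rfl := eq_of_add_I_mul_eq_one h
    rw [im_I_mul_sub_one] at hz1 hz2
    have hH : H := by
      rw [hstrip]
      refine ⟨hz1.lt_of_ne ?_, hz2.lt_of_ne ?_⟩
      · intro h; rcases min_choice 0 (-b) with h' | h' <;> rw [h'] at h
        · exact h₁ (by linarith)
        · exact h₂ (by linarith)
      · intro h; rcases max_choice 0 (-b) with h' | h' <;> rw [h'] at h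
        · exact h₁ (by linarith)
        · exact h₂ (by linarith)
    exact hzS (by simp [S, hH])

lemma sign_mul_self_eq_abs (b : ℝ) : (Real.sign b : ℂ) * b = (|b| : ℝ) := by
  rw [← ofReal_mul]
  congr 1
  rcases lt_trichotomy b 0 with h | rfl | h
  · rw [Real.sign_of_neg h, abs_of_neg h]; ring
  · simp
  · rw [Real.sign_of_pos h, abs_of_pos h]; ring

/-- Zero weight also rules out a + b/2 = 1, since the zeta pole would then be the centre of the
strip. Only the first residue survives. -/
theorem integral_zetaCoshIntegrand_of_poleWeight_eq_zero (n : ℕ) {a b : ℝ} (hb : b ≠ 0)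
    (h : poleWeight a b = 0) :
    Integrable (fun v : ℝ => zetaCoshIntegrand n a b v) ∧
      ∫ v : ℝ, zetaCoshIntegrand n a b v = 2 * |b| * riemannZeta (a + b / 2) ^ n := by
  have hw := h
  unfold poleWeight at h
  split_ifs at h with h1 h2 <;> try norm_num at h
  have h3 : a + b / 2 ≠ 1 := by
    intro h3
    rcases hb.lt_or_gt with hb' | hb'
    · exact h1 (Or.inr ⟨hb', by linarith, by linarith⟩)
    · exact h1 (Or.inl ⟨hb', by linarith, by linarith⟩)
  obtain ⟨k1, k2⟩ := integral_zetaCoshIntegrand n hb (by tauto) (by tauto) h3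
  refine ⟨k1, k2.trans ?_⟩
  have hpi : (Real.pi : ℂ) ≠ 0 := by exact_mod_cast Real.pi_ne_zero
  rw [zetaCoshClosedForm, hw, residueOne_eq n hb h3, ← sign_mul_self_eq_abs]
  generalize riemannZeta (a + b / 2) ^ n = w
  field_simp
  linear_combination (-(Real.sign b : ℂ) * b * w * 2) * I_mul_I

/-! ### Continuity in a and coalescing poles -/

lemma zetaCoshIntegrand_norm_le_sum {n : ℕ} {a b : ℝ} (v : ℂ) :
    ‖zetaCoshIntegrand n a b v‖ ≤ ‖riemannZeta (a + I * v) ^ n / cosh (Real.pi * v / b)‖ +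
      ‖riemannZeta (a + b - I * v) ^ n / cosh (Real.pi * v / b)‖ := by
  rw [zetaCoshIntegrand, add_div]
  exact norm_add_le _ _

lemma cosh_ofReal_ne_zero (b x : ℝ) : cosh (Real.pi * x / b : ℂ) ≠ 0 := by
  have : (Real.pi * x / b : ℂ) = ((Real.pi * x / b : ℝ) : ℂ) := by push_cast; rfl
  rw [this, ← Complex.ofReal_cosh]
  exact_mod_cast (Real.cosh_pos _).ne'

lemma add_I_mul_ne_one {a : ℝ} (ha : a ≠ 1) (x : ℝ) : (a + I * x : ℂ) ≠ 1 := fun h => ha (by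
  have := congrArg re h
  simpa using this)

lemma add_sub_I_mul_ne_one {a b : ℝ} (ha : a + b ≠ 1) (x : ℝ) : (a + b - I * x : ℂ) ≠ 1 :=
  fun h => ha (by
    have := congrArg re h
    simpa using this)

lemma continuousAt_zetaCoshIntegrand (n : ℕ) {a b : ℝ} (h₁ : a ≠ 1) (h₂ : a + b ≠ 1) (x : ℝ) :
    ContinuousAt (fun q : ℝ × ℝ => zetaCoshIntegrand n q.1 b q.2) (a, x) := by
  unfold zetaCoshIntegrand
  have c1 : ContinuousAt (fun q : ℝ × ℝ => riemannZeta (q.1 + I * q.2)) (a, x) :=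
    ContinuousAt.comp (f := fun q : ℝ × ℝ => (q.1 + I * q.2 : ℂ)) (g := riemannZeta)
      (differentiableAt_riemannZeta (add_I_mul_ne_one h₁ x)).continuousAt (by fun_prop)
  have c2 : ContinuousAt (fun q : ℝ × ℝ => riemannZeta (q.1 + b - I * q.2)) (a, x) :=
    ContinuousAt.comp (f := fun q : ℝ × ℝ => (q.1 + b - I * q.2 : ℂ)) (g := riemannZeta)
      (differentiableAt_riemannZeta (add_sub_I_mul_ne_one h₂ x)).continuousAt (by fun_prop)
  have c3 : ContinuousAt (fun q : ℝ × ℝ => cosh (Real.pi * q.2 / b : ℂ)) (a, x) := by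
    have : Continuous (fun q : ℝ × ℝ => cosh (Real.pi * q.2 / b : ℂ)) :=
      Complex.continuous_cosh.comp (by fun_prop)
    exact this.continuousAt
  exact ((c1.pow n).add (c2.pow n)).div c3 (cosh_ofReal_ne_zero b x)

/-- The integral depends continuously on `a` off the lines `a = 1` and `a + b = 1`. -/
theorem continuousAt_integral_zetaCoshIntegrand (n : ℕ) {a b : ℝ} (hb : b ≠ 0) (h₁ : a ≠ 1)
    (h₂ : a + b ≠ 1) :
    Integrable (fun v : ℝ => zetaCoshIntegrand n a b v) ∧
      Tendsto (fun a' : ℝ => ∫ v : ℝ, zetaCoshIntegrand n a' b v) (𝓝 a)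
        (𝓝 (∫ v : ℝ, zetaCoshIntegrand n a b v)) := by
  -- For a' in this compact interval the zeta poles stay off the real line, so joint continuity
  -- bounds the integrand on a rectangle and the cosh estimate bounds it outside, uniformly in a'.
  obtain ⟨δ, hδ0, hδ⟩ : ∃ δ > 0, ∀ a' ∈ Set.Icc (a - δ) (a + δ), a' ≠ 1 ∧ a' + b ≠ 1 := by
    have h : {a' : ℝ | a' ≠ 1 ∧ a' + b ≠ 1} ∈ 𝓝 a :=
      ((isOpen_ne.preimage continuous_id).inter
        (isOpen_ne.preimage (continuous_add_const b))).mem_nhds ⟨h₁, h₂⟩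
    obtain ⟨δ, hδ0, hδ⟩ := Metric.nhds_basis_closedBall.mem_iff.1 h
    exact ⟨δ, hδ0, fun a' ha' => hδ (by rwa [Real.closedBall_eq_Icc])⟩
  obtain ⟨C₁, T₁, hT₁, hC₁, hd₁⟩ :=
    (polynomialGrowth_riemannZeta_pow n).exists_norm_div_cosh_le hb (a - δ) (a + δ)
  obtain ⟨C₂, T₂, hT₂, hC₂, hd₂⟩ :=
    (polynomialGrowth_riemannZeta_pow n).exists_norm_div_cosh_le hb (a - δ + b) (a + δ + b)
  set T := max T₁ T₂ with hT
  have hT0 : 0 < T := lt_max_of_lt_left hT₁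
  have hcont : ContinuousOn (fun q : ℝ × ℝ => zetaCoshIntegrand n q.1 b q.2)
      (Set.Icc (a - δ) (a + δ) ×ˢ Set.Icc (-T) T) := fun q hq =>
    (continuousAt_zetaCoshIntegrand n (hδ q.1 hq.1).1 (hδ q.1 hq.1).2 q.2).continuousWithinAt
  obtain ⟨B, hB⟩ := (isCompact_Icc.prod isCompact_Icc).exists_bound_of_continuousOn hcont
  have hB0 : 0 ≤ B := (norm_nonneg _).trans
    (hB (a, 0) ⟨⟨by linarith, by linarith⟩, ⟨by linarith, by linarith⟩⟩)
  have hbound : ∀ a' ∈ Set.Icc (a - δ) (a + δ), ∀ x : ℝ, ‖zetaCoshIntegrand n a' b x‖ ≤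
      (B * (1 + T ^ 2) + (C₁ + C₂) * (1 + T ^ 2) / T ^ 2) * (1 + x ^ 2)⁻¹ := by
    intro a' ha' x
    refine le_mul_inv_one_add_sq hT0 hB0 (by positivity) (fun hx => ?_)
      fun hx => hB (a', x) ⟨ha', abs_le.1 hx⟩
    refine (zetaCoshIntegrand_norm_le_sum _).trans ?_
    rw [add_div]
    refine add_le_add ?_ ?_
    · simpa using hd₁ (a' + I * x) x (by simpa using ha'.1) (by simpa using ha'.2) (by simp)
        (by simpa using (le_max_left _ _).trans hx)
    · simpa using hd₂ (a' + b - I * x) x (by simpa using ha'.1) (by simpa using ha'.2) (by simp)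
        (by simpa using (le_max_right _ _).trans hx)
  have hmeas : ∀ a' ∈ Set.Icc (a - δ) (a + δ),
      AEStronglyMeasurable (fun v : ℝ => zetaCoshIntegrand n a' b v) := fun a' ha' => by
    refine Continuous.aestronglyMeasurable (continuous_iff_continuousAt.2 fun x => ?_)
    exact ContinuousAt.comp (f := fun v : ℝ => (a', v))
      (continuousAt_zetaCoshIntegrand n (hδ a' ha').1 (hδ a' ha').2 x) (by fun_prop)
  have ha : a ∈ Set.Icc (a - δ) (a + δ) := ⟨by linarith, by linarith⟩
  have hev : ∀ᶠ a' in 𝓝 a, a' ∈ Set.Icc (a - δ) (a + δ) :=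
    Icc_mem_nhds (by linarith) (by linarith)
  refine ⟨(integrable_inv_one_add_sq.const_mul _).mono' (hmeas a ha)
    (Eventually.of_forall (hbound a ha)), ?_⟩
  refine tendsto_integral_filter_of_dominated_convergence _ (hev.mono hmeas)
    (hev.mono fun a' ha' => Eventually.of_forall (hbound a' ha'))
    (integrable_inv_one_add_sq.const_mul _) (Eventually.of_forall fun x => ?_)
  exact ContinuousAt.tendsto (ContinuousAt.comp (f := fun a' : ℝ => (a', x))
    (continuousAt_zetaCoshIntegrand n h₁ h₂ x) (by fun_prop))

/-- For a' near a but different from it, the closed form equals the integral, which is continuous at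
a because the merging poles are away from the real line. -/
theorem tendsto_zetaCoshClosedForm (n : ℕ) {a b : ℝ} (hb : b ≠ 0) (h : a + b / 2 = 1) :
    Integrable (fun v : ℝ => zetaCoshIntegrand n a b v) ∧
      Tendsto (fun a' : ℝ => zetaCoshClosedForm n a' b) (𝓝[≠] a)
        (𝓝 (∫ v : ℝ, zetaCoshIntegrand n a b v)) := by
  have h₁ : a ≠ 1 := fun h' => hb (by linarith)
  have h₂ : a + b ≠ 1 := fun h' => hb (by linarith)
  obtain ⟨k1, k2⟩ := continuousAt_integral_zetaCoshIntegrand n hb h₁ h₂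
  refine ⟨k1, (k2.mono_left nhdsWithin_le_nhds).congr' ?_⟩
  have ho : {a' : ℝ | a' ≠ 1 ∧ a' + b ≠ 1} ∈ 𝓝 a :=
    ((isOpen_ne.preimage continuous_id).inter
      (isOpen_ne.preimage (continuous_add_const b))).mem_nhds ⟨h₁, h₂⟩
  filter_upwards [nhdsWithin_le_nhds ho, self_mem_nhdsWithin] with a' ha' hne
  exact (integral_zetaCoshIntegrand n hb ha'.1 ha'.2
    (fun h' => hne (by simp only [Set.mem_singleton_iff]; linarith))).2

/-! ### Principal values for a simple pole at the origin -/

/-- Principal values: an odd singular part does not contribute. -/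
lemma tendsto_setIntegral_abs_gt {f g q : ℝ → ℂ} (hg : Integrable g)
    (hfg : ∀ x ≠ 0, f x = g x + q x) (hq : ∀ x, q (-x) = -q x)
    (hqi : ∀ ε : ℝ, 0 < ε → IntegrableOn q {x | ε < |x|}) :
    (∀ ε : ℝ, 0 < ε → IntegrableOn f {x | ε < |x|}) ∧
      Tendsto (fun ε : ℝ => ∫ x in {x : ℝ | ε < |x|}, f x) (𝓝[>] 0) (𝓝 (∫ x, g x)) := by
  have hm : ∀ ε : ℝ, MeasurableSet {x : ℝ | ε < |x|} := fun ε =>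
    (isOpen_lt continuous_const continuous_abs).measurableSet
  have hcongr : ∀ ε : ℝ, 0 < ε → Set.EqOn f (fun x => g x + q x) {x | ε < |x|} :=
    fun ε hε x hx => hfg x (by rintro rfl; simp at hx; linarith)
  refine ⟨fun ε hε => ((hg.integrableOn.add (hqi ε hε)).congr_fun (hcongr ε hε).symm (hm ε)), ?_⟩
  have hcover : AECover volume (𝓝[>] (0 : ℝ)) fun ε : ℝ => {x : ℝ | ε < |x|} := by
    refine ⟨?_, hm⟩
    have : ∀ᵐ x : ℝ, x ≠ 0 := by simp [ae_iff]
    filter_upwards [this] with x hx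
    exact nhdsWithin_le_nhds (Iio_mem_nhds (abs_pos.2 hx))
  refine (hcover.integral_tendsto_of_countably_generated hg).congr' ?_
  filter_upwards [self_mem_nhdsWithin] with ε hε
  have hε : 0 < ε := hε
  rw [setIntegral_congr_fun (hm ε) (hcongr ε hε), integral_add hg.integrableOn (hqi ε hε)]
  have : ∫ x in {x : ℝ | ε < |x|}, q x = 0 := by
    rw [← integral_indicator (hm ε)]
    refine integral_odd_eq_zero fun x => ?_
    by_cases hx : ε < |x|
    · rw [Set.indicator_of_mem (show x ∈ {x : ℝ | ε < |x|} from hx),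
        Set.indicator_of_mem (show -x ∈ {x : ℝ | ε < |x|} by simpa using hx), hq]
    · rw [Set.indicator_of_notMem (show x ∉ {x : ℝ | ε < |x|} from hx),
        Set.indicator_of_notMem (show -x ∉ {x : ℝ | ε < |x|} by simpa using hx), neg_zero]
  rw [this, add_zero]

/-- The kernel `1 / (i v cosh (π v / b))`. -/
noncomputable def invMulCosh (b : ℝ) (v : ℂ) : ℂ := (I * v)⁻¹ / cosh (Real.pi * v / b)

lemma invMulCosh_neg (b : ℝ) (v : ℂ) : invMulCosh b (-v) = -invMulCosh b v := by
  rw [invMulCosh, invMulCosh, mul_neg, inv_neg, neg_div, mul_neg, neg_div, Complex.cosh_neg]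

lemma stripDecay_invMulCosh {b : ℝ} (hb : b ≠ 0) (y₁ y₂ : ℝ) :
    StripDecay (invMulCosh b) y₁ y₂ := by
  have := polynomialGrowth_inv_sub_one.stripDecay hb 1 y₁ y₂
  simp only [ofReal_one, add_sub_cancel_left] at this
  exact this

lemma differentiableAt_invMulCosh {b : ℝ} {v : ℂ} (h₀ : v ≠ 0)
    (h : cosh (Real.pi * v / b) ≠ 0) : DifferentiableAt ℂ (invMulCosh b) v :=
  DifferentiableAt.fun_div (by fun_prop (disch := simpa using h₀))
    (analyticAt_cosh_mul_div b v).differentiableAt h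

lemma meromorphicAt_invMulCosh (b : ℝ) (v : ℂ) : MeromorphicAt (invMulCosh b) v :=
  MeromorphicAt.fun_div (by fun_prop) (analyticAt_cosh_mul_div b v).meromorphicAt

lemma hasResidue_invMulCosh_zero (b : ℝ) : HasResidue (invMulCosh b) 0 (-I) := by
  have h : HasResidue (fun w => (-I / cosh (Real.pi * w / b)) / w) 0 _ :=
    AnalyticAt.hasResidue_div (h' := 1)
      (analyticAt_const.div (analyticAt_cosh_mul_div b 0) (by simp)) analyticAt_id rfl
      (hasDerivAt_id 0) one_ne_zero
  simp only [mul_zero, zero_div, cosh_zero, div_one] at h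
  refine h.congr (Eventually.of_forall fun w => ?_)
  simp only [invMulCosh, mul_inv, inv_I]
  ring

lemma hasResidue_invMulCosh_half_period {b : ℝ} (hb : b ≠ 0) :
    HasResidue (invMulCosh b) (-(I * b / 2)) (2 * I / Real.pi) := by
  have hb' : (b : ℂ) ≠ 0 := by exact_mod_cast hb
  have hpi : (Real.pi : ℂ) ≠ 0 := by exact_mod_cast Real.pi_ne_zero
  have ha : AnalyticAt ℂ (fun s : ℂ => (s - 1)⁻¹) ((1 : ℝ) + b / 2) := by
    fun_prop (disch := simpa using hb)
  have h := hasResidue_div_cosh_half_period (h := fun s => (s - 1)⁻¹) 1 hb ha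
  simp only [ofReal_one, add_sub_cancel_left] at h
  have e : (2 * I / Real.pi : ℂ) = I * b / Real.pi * (b / 2 : ℂ)⁻¹ := by field_simp
  rw [e]
  exact h

lemma hasResidue_invMulCosh_neg_half_period {b : ℝ} (hb : b ≠ 0) :
    HasResidue (invMulCosh b) (I * b / 2) (2 * I / Real.pi) := by
  have h := hasResidue_invMulCosh_half_period (neg_ne_zero.2 hb)
  have e : invMulCosh (-b) = invMulCosh b := by
    ext v
    rw [invMulCosh, invMulCosh, ofReal_neg, div_neg, Complex.cosh_neg]
  rw [e] at h
  convert h using 1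
  push_cast; ring

lemma integral_invMulCosh_odd (b y : ℝ) : ∫ x : ℝ, invMulCosh b (x + y * I) =
    -∫ x : ℝ, invMulCosh b (x + (-y : ℝ) * I) := by
  rw [← integral_neg_eq_self (fun x : ℝ => invMulCosh b (x + y * I)), ← integral_neg]
  refine integral_congr_ae (Eventually.of_forall fun x => ?_)
  simp only
  rw [← invMulCosh_neg]
  congr 1
  push_cast; ring

/-- The lines Im v = ±|b| enclose the poles 0 and ±ib/2. As the kernel is odd, the two line
integrals are opposite, so the residue sum gives twice the value: 2πi(-i + 4i/π) = 2(π-4). -/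
lemma integral_invMulCosh_line {b : ℝ} (hb : b ≠ 0) :
    ∫ x : ℝ, invMulCosh b (x + (-|b| : ℝ) * I) = Real.pi - 4 := by
  have hb' : (b : ℂ) ≠ 0 := by exact_mod_cast hb
  have hpi : (Real.pi : ℂ) ≠ 0 := by exact_mod_cast Real.pi_ne_zero
  have hbpos := abs_pos.2 hb
  have hIb : (I * b / 2 : ℂ) ≠ 0 := by simp [hb]
  have hne : (I * b / 2 : ℂ) ≠ -(I * b / 2) := fun h => hIb (self_eq_neg.1 h)
  have him : (I * b / 2 : ℂ).im = b / 2 := by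
    have : (I * b / 2 : ℂ) = ((b / 2 : ℝ) : ℂ) * I := by push_cast; ring
    rw [this]; simp
  let S : Finset ℂ := {0, I * b / 2, -(I * b / 2)}
  let ρ : ℂ → ℂ := fun z => if z = 0 then -I else 2 * I / Real.pi
  have key := integral_line_sub_integral_line (y₁ := -|b|) (y₂ := |b|) (by linarith) S ρ
    (stripDecay_invMulCosh hb _ _) ?_ (fun z _ => meromorphicAt_invMulCosh b z) ?_ ?_
  · have hsum : ∑ z ∈ S, ρ z = -I + (2 * I / Real.pi + 2 * I / Real.pi) := by
      simp only [S]
      rw [Finset.sum_insert (by simp [hIb.symm, hb]), Finset.sum_pair hne]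
      simp [ρ, hb]
    rw [integral_invMulCosh_odd b |b|, hsum, sub_neg_eq_add, ← two_mul] at key
    refine mul_left_cancel₀ (two_ne_zero (α := ℂ)) (key.trans ?_)
    field_simp
    linear_combination (4 - (Real.pi : ℂ)) * I_mul_I
  · intro z hz
    simp only [S, Finset.mem_insert, Finset.mem_singleton] at hz
    have := abs_lt.1 (show |b / 2| < |b| by rw [abs_div, abs_two]; linarith)
    rcases hz with rfl | rfl | rfl
    · simp [hb]
    · rw [him]; exact this
    · rw [neg_im, him]; constructor <;> linarith [this.1, this.2]
  · intro z hz
    simp only [S, Finset.mem_insert, Finset.mem_singleton] at hz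
    rcases hz with rfl | rfl | rfl
    · simpa [ρ] using hasResidue_invMulCosh_zero b
    · simpa [ρ, hb] using hasResidue_invMulCosh_neg_half_period hb
    · simpa [ρ, hb] using hasResidue_invMulCosh_half_period hb
  · intro z h1 h2 hz
    simp only [S, Finset.mem_insert, Finset.mem_singleton, not_or] at hz
    refine differentiableAt_invMulCosh hz.1 fun h => ?_
    obtain ⟨k, hk, hkim⟩ := im_eq_of_cosh_eq_zero hb h
    have h3 : |z.im| ≤ |b| := abs_le.2 ⟨h1, h2⟩
    rw [hkim, abs_neg, abs_div, abs_mul, abs_two] at h3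
    have h4 : |(2 * k + 1 : ℝ)| ≤ 2 := by
      by_contra h5
      have := mul_lt_mul_of_pos_left (not_le.1 h5) hbpos
      linarith
    have h5 : |2 * k + 1| ≤ 2 := by exact_mod_cast h4
    rw [abs_le] at h5
    obtain rfl | rfl : k = 0 ∨ k = -1 := by omega
    · exact hz.2.2 (by rw [hk]; push_cast; ring)
    · exact hz.2.1 (by rw [hk]; push_cast; ring)

lemma inv_sub_I_mul_div_cosh_eq {b : ℝ} (hb : b ≠ 0) (v : ℂ) :
    (b - I * v)⁻¹ / cosh (Real.pi * v / b) = invMulCosh b (v + b * I) := by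
  have e : (v + b * I : ℂ) = -(-(I * b) - v) := by ring
  have e2 : (I * (-(I * b) - v) : ℂ) = b - I * v := by linear_combination -(b : ℂ) * I_mul_I
  rw [e, invMulCosh_neg, invMulCosh, cosh_reflect hb, e2, div_neg, neg_neg]

/-- The polar part of the second zeta term is the kernel `invMulCosh` on the line Im v = b; the sign
of b decides which of the two opposite values occurs. -/
lemma integral_inv_sub_I_mul_div_cosh {b : ℝ} (hb : b ≠ 0) :
    Integrable (fun v : ℝ => (b - I * v : ℂ)⁻¹ / cosh (Real.pi * v / b)) ∧
      ∫ v : ℝ, (b - I * v : ℂ)⁻¹ / cosh (Real.pi * v / b) =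
        (Real.sign b : ℂ) * (4 - Real.pi) := by
  simp only [inv_sub_I_mul_div_cosh_eq hb]
  refine ⟨(stripDecay_invMulCosh hb b b).integrable le_rfl le_rfl fun z hz => ?_, ?_⟩
  · refine (differentiableAt_invMulCosh (by rintro rfl; exact hb hz.symm) fun h => ?_).continuousAt
    obtain ⟨k, -, hk⟩ := im_eq_of_cosh_eq_zero hb h
    rw [hz] at hk
    have h1 : (2 * k + 3 : ℝ) = 0 := by
      have : b * (2 * k + 3) = 0 := by linarith
      exact (mul_eq_zero.1 this).resolve_left hb
    have h2 : 2 * k + 3 = 0 := by exact_mod_cast h1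
    omega
  · have h := integral_invMulCosh_line hb
    rcases hb.lt_or_gt with hb' | hb'
    · rw [abs_of_neg hb', neg_neg] at h
      rw [h, Real.sign_of_neg hb']; push_cast; ring
    · rw [abs_of_pos hb'] at h
      rw [integral_invMulCosh_odd, h, Real.sign_of_pos hb']; push_cast; ring

lemma integrable_one_div_cosh {b : ℝ} (hb : b ≠ 0) :
    Integrable fun v : ℝ => 1 / cosh (Real.pi * v / b : ℂ) := by
  have h := ((polynomialGrowth_riemannZeta_pow 0).stripDecay hb 1 0 0).integrable le_rfl le_rfl
    fun z hz => ?_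
  · simpa using h
  · have hz' : z = (z.re : ℂ) := Complex.ext rfl (by simpa using hz)
    simp only [pow_zero]
    exact continuousAt_const.div (analyticAt_cosh_mul_div b z).continuousAt
      (by rw [hz']; exact cosh_ofReal_ne_zero b z.re)

lemma residueTwo_one {a b : ℝ} (hc : Real.cos (Real.pi * (a - 1) / b) ≠ 0) :
    residueTwo 1 a b = -(I / Real.cos (Real.pi * (a - 1) / b)) := by
  have e : (Real.pi * (I * (a - 1)) / b : ℂ) = ((Real.pi * (a - 1) / b : ℝ) : ℂ) * I := by
    push_cast; ring
  have hcosh : cosh (Real.pi * (I * (a - 1)) / b) = (Real.cos (Real.pi * (a - 1) / b) : ℂ) := by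
    rw [e, Complex.cosh_mul_I, ← Complex.ofReal_cos]
  have hn : AnalyticAt ℂ (fun v : ℂ => -I * riemannZeta₁ (a + I * v) / cosh (Real.pi * v / b))
      (I * (a - 1)) := by
    have : Differentiable ℂ (fun v : ℂ => -I * riemannZeta₁ (a + I * v)) := by fun_prop
    exact (this.analyticAt _).fun_div (analyticAt_cosh_mul_div b _)
      (by rw [hcosh]; exact_mod_cast hc)
  have h := hn.hasResidue_div (h := fun v => v - I * (a - 1)) (h' := 1) (by fun_prop) (sub_self _)
    ((hasDerivAt_id _).sub_const _) one_ne_zero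
  rw [I_mul_I_mul_sub_one, hcosh, riemannZeta₁_one] at h
  have h2 : HasResidue (zetaTermLeft 1 a b) (I * (a - 1)) _ := h.congr (by
    filter_upwards [self_mem_nhdsWithin] with v hv
    rw [zetaTermLeft_eq hv, pow_one, pow_one, mul_inv, inv_I]
    ring)
  rw [residueTwo, h2.complexResidue_eq]
  ring

/-- The principal value in the case of a simple pole at the origin. -/
theorem tendsto_principalValue_of_eq_one {b : ℝ} (hb : b ≠ 0) :
    (∀ ε : ℝ, 0 < ε → IntegrableOn (fun v : ℝ => zetaCoshIntegrand 1 1 b v) {v : ℝ | ε < |v|}) ∧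
      Tendsto (fun ε : ℝ => ∫ v in {v : ℝ | ε < |v|}, zetaCoshIntegrand 1 1 b v) (𝓝[>] 0)
        (𝓝 (zetaCoshClosedForm 1 1 b)) := by
  have hb' : (b : ℂ) ≠ 0 := by exact_mod_cast hb
  have hpi : (Real.pi : ℂ) ≠ 0 := by exact_mod_cast Real.pi_ne_zero
  have h3 : (1 : ℝ) + b / 2 ≠ 1 := by simpa using hb
  have hζ₀ : ∀ z : ℂ, AnalyticAt ℂ riemannZeta₀ z := differentiable_riemannZeta₀.analyticAt
  have hcz : ∀ z : ℂ, DifferentiableAt ℂ (fun v : ℂ => riemannZeta₀ ((1 : ℝ) + I * v)) z :=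
    fun z => by fun_prop
  -- With ζ replaced by its entire part, the only singularity in the closed strip is the zero of
  -- cosh.
  obtain ⟨i0, e0⟩ := polynomialGrowth_riemannZeta₀.integral_symm_div_cosh hb 1 {-(I * b / 2)}
    (fun _ => I * b / Real.pi * riemannZeta₀ ((1 : ℝ) + b / 2))
    (fun z hz => by rw [Finset.mem_singleton.1 hz]; exact half_period_mem_strip hb)
    (fun z _ => by
      have : Differentiable ℂ (fun v : ℂ => riemannZeta₀ ((1 : ℝ) + I * v)) := hcz
      exact (this.analyticAt z).meromorphicAt.fun_div
        (analyticAt_cosh_mul_div b z).meromorphicAt)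
    (fun z hz => by
      rw [Finset.mem_singleton.1 hz]
      exact hasResidue_div_cosh_half_period 1 hb (hζ₀ _))
    (fun z h1 h2 hz => (hcz z).fun_div (analyticAt_cosh_mul_div b z).differentiableAt
      fun h => hz (Finset.mem_singleton.2 (eq_of_cosh_eq_zero_of_mem_strip hb h h1 h2)))
  obtain ⟨i1, e1⟩ := integral_inv_sub_I_mul_div_cosh hb
  have hqc : ContinuousOn (fun v : ℝ => invMulCosh b v) {v : ℝ | v ≠ 0} := fun v hv =>
    (ContinuousAt.comp (f := fun v : ℝ => (v : ℂ)) (differentiableAt_invMulCosh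
      (by exact_mod_cast hv) (cosh_ofReal_ne_zero b v)).continuousAt (by fun_prop)).continuousWithinAt
  have hqi : ∀ ε : ℝ, 0 < ε → IntegrableOn (fun v : ℝ => invMulCosh b v) {v | ε < |v|} := by
    intro ε hε
    have hm : MeasurableSet {x : ℝ | ε < |x|} :=
      (isOpen_lt continuous_const continuous_abs).measurableSet
    have hsub : {x : ℝ | ε < |x|} ⊆ {v : ℝ | v ≠ 0} := fun x hx => by
      rintro rfl; simp at hx; linarith
    have hsech : Integrable fun v : ℝ => 1 / cosh (Real.pi * v / b : ℂ) := integrable_one_div_cosh hb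
    refine Integrable.mono' (g := fun v : ℝ => ε⁻¹ * ‖1 / cosh (Real.pi * v / b : ℂ)‖)
      (hsech.norm.const_mul _).integrableOn ((hqc.mono hsub).aestronglyMeasurable hm)
      ((ae_restrict_iff' hm).2 (Eventually.of_forall fun x hx => ?_))
    have hx : ε < |x| := hx
    rw [invMulCosh, norm_div, norm_div, norm_inv, norm_mul, norm_I, one_mul, Complex.norm_real,
      Real.norm_eq_abs, norm_one, one_div, div_eq_mul_inv]
    gcongr
  -- Three pieces: the entire part, the polar part of the second zeta term (regular on the real
  -- line), and the odd kernel carrying the singularity at 0.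
  have hfg : ∀ v : ℝ, v ≠ 0 → zetaCoshIntegrand 1 1 b v =
      ((riemannZeta₀ ((1 : ℝ) + I * v) + riemannZeta₀ ((1 : ℝ) + b - I * v)) /
        cosh (Real.pi * v / b) + (b - I * v : ℂ)⁻¹ / cosh (Real.pi * v / b)) +
        invMulCosh b v := fun v hv => by
    have n1 : ((1 : ℝ) + I * v : ℂ) ≠ 1 := by simpa using hv
    have n2 : ((1 : ℝ) + b - I * v : ℂ) ≠ 1 := add_sub_I_mul_ne_one (by simpa using hb) v
    rw [zetaCoshIntegrand, pow_one, pow_one, riemannZeta_eq_inv_sub_add n1,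
      riemannZeta_eq_inv_sub_add n2, invMulCosh]
    have s1 : ((1 : ℝ) + I * v - 1 : ℂ) = I * v := by push_cast; ring
    have s2 : ((1 : ℝ) + b - I * v - 1 : ℂ) = b - I * v := by push_cast; ring
    rw [s1, s2]
    ring
  have key := tendsto_setIntegral_abs_gt (i0.add i1) hfg
    (fun x => by push_cast; exact invMulCosh_neg b x) hqi
  refine ⟨key.1, ?_⟩
  convert key.2 using 2
  have hw : poleWeight 1 b = 1 / 2 := by simp [poleWeight]
  have hζ : riemannZeta ((1 : ℝ) + b / 2) = (b / 2 : ℂ)⁻¹ + riemannZeta₀ ((1 : ℝ) + b / 2) := by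
    rw [riemannZeta_eq_inv_sub_add (by exact_mod_cast h3)]
    congr 2
    push_cast; ring
  rw [integral_add' i0 i1, e0, e1, zetaCoshClosedForm, residueThree_eq_residueTwo 1 1 hb,
    residueOne_eq 1 hb h3, hw, residueTwo_one (by simp), hζ, Finset.sum_singleton]
  simp only [sub_self, mul_zero, zero_div, Real.cos_zero, ofReal_one, div_one, pow_one]
  generalize riemannZeta₀ (1 + b / 2) = w
  field_simp
  ring_nf
  simp only [I_sq]
  ring

/-- Replacing (b, v) by (-b, -v) interchanges the two zeta terms, which reduces a + b = 1 to a = 1.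
-/
lemma zetaCoshIntegrand_one_sub {b : ℝ} (v : ℝ) :
    zetaCoshIntegrand 1 (1 - b) b v = zetaCoshIntegrand 1 1 (-b) (-v : ℝ) := by
  simp only [zetaCoshIntegrand, pow_one]
  have e1 : (((1 - b : ℝ) : ℂ) + I * v) = (1 : ℝ) + (-b : ℝ) - I * (-v : ℝ) := by push_cast; ring
  have e2 : (((1 - b : ℝ) : ℂ) + b - I * v) = (1 : ℝ) + I * (-v : ℝ) := by push_cast; ring
  have e3 : (Real.pi * v / b : ℂ) = Real.pi * (-v : ℝ) / (-b : ℝ) := by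
    push_cast; rw [mul_neg, neg_div_neg_eq]
  rw [e1, e2, e3, add_comm]

/-- The principal value in the mirrored case. -/
theorem tendsto_principalValue_of_add_eq_one {a b : ℝ} (hb : b ≠ 0) (hab : a + b = 1) :
    (∀ ε : ℝ, 0 < ε → IntegrableOn (fun v : ℝ => zetaCoshIntegrand 1 a b v) {v : ℝ | ε < |v|}) ∧
      Tendsto (fun ε : ℝ => ∫ v in {v : ℝ | ε < |v|}, zetaCoshIntegrand 1 a b v) (𝓝[>] 0)
        (𝓝 (zetaCoshClosedForm 1 a b)) := by
  obtain rfl : a = 1 - b := by linarith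
  have hnb := neg_ne_zero.2 hb
  have hm : ∀ ε : ℝ, MeasurableSet {x : ℝ | ε < |x|} := fun ε =>
    (isOpen_lt continuous_const continuous_abs).measurableSet
  have hind : ∀ ε x : ℝ, Set.indicator {x : ℝ | ε < |x|}
      (fun v : ℝ => zetaCoshIntegrand 1 (1 - b) b v) x = Set.indicator {x : ℝ | ε < |x|}
      (fun v : ℝ => zetaCoshIntegrand 1 1 (-b) v) (-x) := fun ε x => by
    by_cases hx : ε < |x|
    · rw [Set.indicator_of_mem (show x ∈ {x : ℝ | ε < |x|} from hx),
        Set.indicator_of_mem (show -x ∈ {x : ℝ | ε < |x|} by simpa using hx)]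
      exact_mod_cast zetaCoshIntegrand_one_sub x
    · rw [Set.indicator_of_notMem (show x ∉ {x : ℝ | ε < |x|} from hx),
        Set.indicator_of_notMem (show -x ∉ {x : ℝ | ε < |x|} by simpa using hx)]
  obtain ⟨k1, k2⟩ := tendsto_principalValue_of_eq_one hnb
  refine ⟨fun ε hε => ?_, ?_⟩
  · have := k1 ε hε
    rw [← integrable_indicator_iff (hm ε)] at this ⊢
    refine this.comp_neg.congr (Eventually.of_forall fun x => ?_)
    simpa using (hind ε x).symm
  · convert k2 using 2
    · rename_i ε
      rw [← integral_indicator (hm ε), ← integral_indicator (hm ε),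
        ← integral_neg_eq_self (Set.indicator _ _)]
      simp only [hind, neg_neg]
    · have e1 : (1 - b) + b / 2 ≠ 1 := fun h => hb (by linarith)
      have e2 : (1 : ℝ) + -b / 2 ≠ 1 := fun h => hb (by linarith)
      have w1 : poleWeight (1 - b) b = 1 / 2 := by simp [poleWeight]
      have w2 : poleWeight 1 (-b) = 1 / 2 := by simp [poleWeight]
      -- The cosines -1 and 1 give the zeta residues opposite signs in the two settings;
      -- `residueOne` changes sign with b as well, and sgn(-b) compensates both.
      have c1 : Real.cos (Real.pi * (1 - b - 1) / b) = -1 := by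
        rw [show Real.pi * (1 - b - 1) / b = -Real.pi by field_simp; ring, Real.cos_neg,
          Real.cos_pi]
      have c2 : Real.cos (Real.pi * (1 - 1) / -b) = 1 := by simp
      have s : Real.sign (-b) = -Real.sign b := Real.sign_neg
      rw [zetaCoshClosedForm, zetaCoshClosedForm, residueThree_eq_residueTwo 1 _ hb,
        residueThree_eq_residueTwo 1 _ hnb, residueOne_eq 1 hb e1, residueOne_eq 1 hnb e2,
        w1, w2, residueTwo_one (by rw [c1]; norm_num), residueTwo_one (by rw [c2]; norm_num),
        c1, c2, s]
      have ez : ((1 - b : ℝ) + b / 2 : ℂ) = (1 : ℝ) + (-b : ℝ) / 2 := by push_cast; ring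
      rw [ez]
      push_cast
      ring

/-! ### Third-order Taylor jets and residues at poles of order two to four -/

/-- Taylor expansion to third order with an analytic remainder. -/
def HasCubicJet (f : ℂ → ℂ) (z p₀ p₁ p₂ p₃ : ℂ) : Prop :=
  ∃ r : ℂ → ℂ, AnalyticAt ℂ r z ∧ ∀ᶠ w in 𝓝 z, f w =
    p₀ + p₁ * (w - z) + p₂ * (w - z) ^ 2 + p₃ * (w - z) ^ 3 + (w - z) ^ 4 * r w

lemma HasCubicJet.mul {f g : ℂ → ℂ} {z p₀ p₁ p₂ p₃ q₀ q₁ q₂ q₃ : ℂ}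
    (hf : HasCubicJet f z p₀ p₁ p₂ p₃) (hg : HasCubicJet g z q₀ q₁ q₂ q₃) :
    HasCubicJet (fun w => f w * g w) z (p₀ * q₀) (p₀ * q₁ + p₁ * q₀)
      (p₀ * q₂ + p₁ * q₁ + p₂ * q₀) (p₀ * q₃ + p₁ * q₂ + p₂ * q₁ + p₃ * q₀) := by
  obtain ⟨r, hr, hfr⟩ := hf
  obtain ⟨s, hs, hgs⟩ := hg
  refine ⟨fun w => (p₁ * q₃ + p₂ * q₂ + p₃ * q₁) + (p₂ * q₃ + p₃ * q₂) * (w - z) +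
    p₃ * q₃ * (w - z) ^ 2 +
    r w * (q₀ + q₁ * (w - z) + q₂ * (w - z) ^ 2 + q₃ * (w - z) ^ 3) +
    s w * (p₀ + p₁ * (w - z) + p₂ * (w - z) ^ 2 + p₃ * (w - z) ^ 3) +
    (w - z) ^ 4 * r w * s w, by fun_prop, ?_⟩
  filter_upwards [hfr, hgs] with w h1 h2
  rw [h1, h2]
  ring

/-- The four equations say that f·q = 1 + (w-z)⁴r for the cubic q with coefficients qᵢ; hence 1/f =
q - (w-z)⁴ r/f. -/
lemma HasCubicJet.inv {f : ℂ → ℂ} {z p₀ p₁ p₂ p₃ q₀ q₁ q₂ q₃ : ℂ}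
    (hf : HasCubicJet f z p₀ p₁ p₂ p₃) (hfa : AnalyticAt ℂ f z) (hz : f z ≠ 0)
    (h₀ : p₀ * q₀ = 1) (h₁ : p₀ * q₁ + p₁ * q₀ = 0) (h₂ : p₀ * q₂ + p₁ * q₁ + p₂ * q₀ = 0)
    (h₃ : p₀ * q₃ + p₁ * q₂ + p₂ * q₁ + p₃ * q₀ = 0) :
    HasCubicJet (fun w => (f w)⁻¹) z q₀ q₁ q₂ q₃ := by
  have hq : HasCubicJet (fun w => q₀ + q₁ * (w - z) + q₂ * (w - z) ^ 2 + q₃ * (w - z) ^ 3) z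
      q₀ q₁ q₂ q₃ := ⟨fun _ => 0, analyticAt_const, Eventually.of_forall fun w => by ring⟩
  obtain ⟨r, hr, h⟩ := hf.mul hq
  refine ⟨fun w => -(r w / f w), (hr.fun_div hfa hz).neg, ?_⟩
  filter_upwards [h, hfa.continuousAt.eventually_ne hz] with w hw hne
  rw [h₀, h₁, h₂, h₃] at hw
  field_simp
  linear_combination -hw

/-- The k-th iterated slope takes the k-th Taylor coefficient as its value at z. Four slope
identities telescope, leaving the fourth slope as an analytic remainder. -/
lemma AnalyticAt.hasCubicJet {f : ℂ → ℂ} {z : ℂ} (hf : AnalyticAt ℂ f z) :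
    HasCubicJet f z (f z) (iteratedDeriv 1 f z) (iteratedDeriv 2 f z / 2)
      (iteratedDeriv 3 f z / 6) := by
  let d : ℕ → ℂ → ℂ := fun k => (Function.swap dslope z)^[k] f
  have hp := hf.hasFPowerSeriesAt
  have hd : ∀ k, d k z = iteratedDeriv k f z / k.factorial := fun k => by
    have h := (hp.has_fpower_series_iterate_dslope_fslope k).coeff_zero (fun _ => 1)
    change _ = d k z at h
    rw [← h]
    have := FormalMultilinearSeries.coeff_iterate_fslope (p := FormalMultilinearSeries.ofScalars ℂ
      fun n => iteratedDeriv n f z / n.factorial) k 0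
    rw [zero_add, FormalMultilinearSeries.coeff_ofScalars] at this
    exact this
  have hs : ∀ k w, (w - z) * d (k + 1) w = d k w - d k z := fun k w => by
    have := sub_smul_dslope (d k) z w
    rw [smul_eq_mul] at this
    simpa only [d, Function.iterate_succ_apply'] using this
  have h0 : ∀ w, d 0 w = f w := fun w => rfl
  refine ⟨d 4, (hp.has_fpower_series_iterate_dslope_fslope 4).analyticAt,
    Eventually.of_forall fun w => ?_⟩
  have e1 := hd 1
  have e2 := hd 2
  have e3 := hd 3
  simp only [Nat.factorial, Nat.cast_one, Nat.mul_one, div_one, Nat.cast_ofNat,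
    Nat.succ_eq_add_one, Nat.reduceAdd, Nat.reduceMul] at e1 e2 e3
  rw [← e1, ← e2, ← e3, ← h0 w, ← h0 z]
  linear_combination -hs 0 w - (w - z) * hs 1 w - (w - z) ^ 2 * hs 2 w - (w - z) ^ 3 * hs 3 w

lemma HasCubicJet.hasResidue {f : ℂ → ℂ} {z p₀ p₁ p₂ p₃ : ℂ}
    (hf : HasCubicJet f z p₀ p₁ p₂ p₃) :
    HasResidue (fun w => ((w - z) ^ 2)⁻¹ * f w) z p₁ ∧
      HasResidue (fun w => ((w - z) ^ 3)⁻¹ * f w) z p₂ ∧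
      HasResidue (fun w => ((w - z) ^ 4)⁻¹ * f w) z p₃ := by
  obtain ⟨r, hr, h⟩ := hf
  have h' := h.filter_mono (nhdsWithin_le_nhds (s := {z}ᶜ))
  refine ⟨?_, ?_, ?_⟩
  · refine (hasResidue_principalPart 1 (fun k => if k = 0 then p₁ else p₀)
      (r := fun w => p₂ + p₃ * (w - z) + (w - z) ^ 2 * r w) (by fun_prop)).congr ?_
    filter_upwards [h', self_mem_nhdsWithin] with w hw hne
    have : w - z ≠ 0 := sub_ne_zero.2 hne
    simp [hw, Finset.sum_range_succ]
    field_simp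
    ring
  · refine (hasResidue_principalPart 2 (fun k => if k = 0 then p₂ else if k = 1 then p₁ else p₀)
      (r := fun w => p₃ + (w - z) * r w) (by fun_prop)).congr ?_
    filter_upwards [h', self_mem_nhdsWithin] with w hw hne
    have : w - z ≠ 0 := sub_ne_zero.2 hne
    simp [hw, Finset.sum_range_succ]
    field_simp
    ring
  · refine (hasResidue_principalPart 3
      (fun k => if k = 0 then p₃ else if k = 1 then p₂ else if k = 2 then p₁ else p₀) hr).congr ?_
    filter_upwards [h', self_mem_nhdsWithin] with w hw hne
    have : w - z ≠ 0 := sub_ne_zero.2 hne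
    simp [hw, Finset.sum_range_succ]
    field_simp
    ring

lemma stieltjesConst_eq (j : ℕ) : stieltjesConst j = (-1) ^ j * iteratedDeriv j riemannZeta₀ 1 := by
  have : Function.update (fun s : ℂ => riemannZeta s - 1 / (s - 1)) 1
      (Real.eulerMascheroniConstant : ℂ) = riemannZeta₀ := by
    ext s
    by_cases hs : s = 1
    · simp [hs]
    · simp [hs, riemannZeta₀]
  rw [stieltjesConst, this]

lemma hasCubicJet_riemannZeta₁ (a : ℝ) :
    HasCubicJet (fun v : ℂ => riemannZeta₁ (a + I * v)) (I * (a - 1)) 1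
      (I * Real.eulerMascheroniConstant) (stieltjesConst 1) (-(I * stieltjesConst 2 / 2)) := by
  obtain ⟨r, hr, h⟩ := (differentiable_riemannZeta₀.analyticAt 1).hasCubicJet
  have e : ∀ v : ℂ, (a + I * v - 1 : ℂ) = I * (v - I * (a - 1)) := fun v => by
    linear_combination ((a : ℂ) - 1) * I_mul_I
  have hc : Tendsto (fun v : ℂ => (a + I * v : ℂ)) (𝓝 (I * (a - 1))) (𝓝 1) := by
    have : ContinuousAt (fun v : ℂ => (a + I * v : ℂ)) (I * (a - 1)) := by fun_prop
    simpa only [ContinuousAt, I_mul_I_mul_sub_one] using this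
  have hra : AnalyticAt ℂ (fun v : ℂ => r (a + I * v)) (I * (a - 1)) :=
    AnalyticAt.comp (f := fun v : ℂ => (a + I * v : ℂ)) (by rwa [I_mul_I_mul_sub_one])
      (by fun_prop)
  -- In (s-1)ζ(s) = 1 + (s-1)ζ₀(s) the jet of ζ₀ is shifted by one degree, so its cubic coefficient
  -- already belongs to the remainder.
  refine ⟨fun v => iteratedDeriv 3 riemannZeta₀ 1 / 6 + I * (v - I * (a - 1)) * r (a + I * v),
    AnalyticAt.add (by fun_prop) (AnalyticAt.mul (by fun_prop) hra), ?_⟩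
  filter_upwards [hc.eventually h] with v hv
  rw [riemannZeta₁, hv, e, riemannZeta₀_one, stieltjesConst_eq, stieltjesConst_eq]
  generalize v - I * (a - 1) = u
  ring_nf
  simp only [I_sq, show I ^ 3 = -I by rw [pow_succ, I_sq]; ring,
    show I ^ 4 = 1 by rw [show 4 = 2 * 2 by norm_num, pow_mul, I_sq]; norm_num,
    show I ^ 5 = I by rw [show 5 = 2 * 2 + 1 by norm_num, pow_succ, pow_mul, I_sq]; norm_num]
  ring

lemma hasCubicJet_cosh (a b : ℝ) :
    HasCubicJet (fun v : ℂ => cosh (Real.pi * v / b)) (I * (a - 1))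
      (Real.cos (Real.pi * (a - 1) / b)) (Real.pi / b * (Real.sin (Real.pi * (a - 1) / b) * I))
      ((Real.pi / b) ^ 2 * Real.cos (Real.pi * (a - 1) / b) / 2)
      ((Real.pi / b) ^ 3 * (Real.sin (Real.pi * (a - 1) / b) * I) / 6) := by
  set c : ℂ := Real.pi / b with hc
  -- A free constant k lets these two rules be chained through the successive derivatives.
  have d1 : ∀ k : ℂ, deriv (fun v : ℂ => k * cosh (Real.pi * v / b)) =
      fun v => k * c * sinh (Real.pi * v / b) := fun k => by
    ext v
    rw [((hasDerivAt_cosh_mul_div b v).const_mul k).deriv]; ring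
  have d2 : ∀ k : ℂ, deriv (fun v : ℂ => k * sinh (Real.pi * v / b)) =
      fun v => k * c * cosh (Real.pi * v / b) := fun k => by
    ext v
    have h : HasDerivAt (fun v : ℂ => (Real.pi * v / b : ℂ)) (Real.pi / b) v := by
      simpa using ((hasDerivAt_id v).const_mul (Real.pi : ℂ)).div_const (b : ℂ)
    rw [(h.csinh.const_mul k).deriv]; ring
  have i0 : iteratedDeriv 0 (fun v : ℂ => cosh (Real.pi * v / b)) =
      fun v => 1 * cosh (Real.pi * v / b) := by simp
  have i1 : iteratedDeriv 1 (fun v : ℂ => cosh (Real.pi * v / b)) =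
      fun v => 1 * c * sinh (Real.pi * v / b) := by rw [iteratedDeriv_succ, i0, d1]
  have i2 : iteratedDeriv 2 (fun v : ℂ => cosh (Real.pi * v / b)) =
      fun v => 1 * c * c * cosh (Real.pi * v / b) := by rw [iteratedDeriv_succ, i1, d2]
  have i3 : iteratedDeriv 3 (fun v : ℂ => cosh (Real.pi * v / b)) =
      fun v => 1 * c * c * c * sinh (Real.pi * v / b) := by rw [iteratedDeriv_succ, i2, d1]
  have e : (Real.pi * (I * (a - 1)) / b : ℂ) = ((Real.pi * (a - 1) / b : ℝ) : ℂ) * I := by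
    push_cast; ring
  have h := (analyticAt_cosh_mul_div b (I * (a - 1))).hasCubicJet
  simp only [i1, i2, i3, e, Complex.cosh_mul_I, Complex.sinh_mul_I, ← Complex.ofReal_cos,
    ← Complex.ofReal_sin] at h
  convert h using 1 <;> ring

lemma hasCubicJet_inv_cosh {a b : ℝ} {C S u : ℂ} (hC : C = Real.cos (Real.pi * (a - 1) / b))
    (hS : S = Real.sin (Real.pi * (a - 1) / b)) (hu : u = Real.pi / b) (hC0 : C ≠ 0) :
    HasCubicJet (fun v : ℂ => (cosh (Real.pi * v / b))⁻¹) (I * (a - 1)) (1 / C)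
      (-(I * u * S / C ^ 2)) (u ^ 2 * (1 / (2 * C) - 1 / C ^ 3))
      (-(I * u ^ 3 * S * (1 / (6 * C ^ 2) - 1 / C ^ 4))) := by
  have hj := hasCubicJet_cosh a b
  rw [← hC, ← hS, ← hu] at hj
  have hCS : S ^ 2 = 1 - C ^ 2 := by
    rw [hC, hS]
    exact_mod_cast Real.sin_sq _
  have e : (Real.pi * (I * (a - 1)) / b : ℂ) = ((Real.pi * (a - 1) / b : ℝ) : ℂ) * I := by
    push_cast; ring
  refine hj.inv (analyticAt_cosh_mul_div b _) ?_ ?_ ?_ ?_ ?_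
  · rw [e, Complex.cosh_mul_I, ← Complex.ofReal_cos, ← hC]; exact hC0
  · field_simp
  · field_simp; ring
  · have hI : I ^ 2 = -1 := I_sq
    field_simp
    ring_nf
    simp only [hI, hCS]
    ring
  · field_simp
    ring

lemma residueTwo_eq_of_hasResidue {n : ℕ} {a b : ℝ} {k : ℂ}
    (h : HasResidue (fun v => ((v - I * (a - 1)) ^ n)⁻¹ *
      (riemannZeta₁ (a + I * v) ^ n / cosh (Real.pi * v / b))) (I * (a - 1)) k) :
    residueTwo n a b = (I ^ n)⁻¹ * k := by
  refine HasResidue.complexResidue_eq ((h.const_mul (I ^ n)⁻¹).congr ?_)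
  filter_upwards [self_mem_nhdsWithin] with v hv
  rw [zetaTermLeft_eq hv, mul_pow, mul_inv]
  ring

/-- With u = v - i(a-1), the residue is i^(-n) times the coefficient of u^(n-1) in the jet of
`riemannZeta₁`(a+iv)^n / cosh(πv/b). -/
theorem residueTwo_eq {a b C S γ : ℝ} (hb : b ≠ 0) (hC : C = Real.cos (Real.pi * (a - 1) / b))
    (hS : S = Real.sin (Real.pi * (a - 1) / b)) (hC0 : C ≠ 0)
    (hγ : γ = Real.eulerMascheroniConstant) :
    residueTwo 2 a b = I * (-(2 * γ / C) + Real.pi * S / (b * C ^ 2)) ∧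
    residueTwo 3 a b =
      I * ((3 * stieltjesConst 1 - 3 * γ ^ 2 + Real.pi ^ 2 / (2 * b ^ 2)) / C
        + 3 * S * Real.pi * γ / (b * C ^ 2) - Real.pi ^ 2 / (b ^ 2 * C ^ 3)) ∧
    residueTwo 4 a b =
      I * ((12 * stieltjesConst 1 * γ - 2 * stieltjesConst 2 - 4 * γ ^ 3
          + 2 * γ * Real.pi ^ 2 / b ^ 2) / C
        - Real.pi * S * (-36 * γ ^ 2 * b ^ 2 + 24 * stieltjesConst 1 * b ^ 2 + Real.pi ^ 2)
          / (6 * b ^ 3 * C ^ 2)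
        - 4 * Real.pi ^ 2 * γ / (b ^ 2 * C ^ 3)
        + Real.pi ^ 3 * S / (b ^ 3 * C ^ 4)) := by
  have hb' : (b : ℂ) ≠ 0 := by exact_mod_cast hb
  have hC0' : (C : ℂ) ≠ 0 := by exact_mod_cast hC0
  have hq := hasCubicJet_inv_cosh (a := a) (b := b) (C := C) (S := S) (u := Real.pi / b)
    (by rw [hC]) (by rw [hS]) rfl hC0'
  have hz := hasCubicJet_riemannZeta₁ a
  rw [← hγ] at hz
  have h2 := ((hz.mul hz).mul hq).hasResidue.1
  have h3 := (((hz.mul hz).mul hz).mul hq).hasResidue.2.1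
  have h4 := ((((hz.mul hz).mul hz).mul hz).mul hq).hasResidue.2.2
  have hI : (-I)⁻¹ = I := by rw [inv_neg, inv_I, neg_neg]
  have I3 : I ^ 3 = -I := by rw [pow_succ, I_sq]; ring
  have I4 : I ^ 4 = 1 := by rw [show 4 = 2 * 2 by norm_num, pow_mul, I_sq]; norm_num
  refine ⟨?_, ?_, ?_⟩
  · rw [residueTwo_eq_of_hasResidue
      (by simpa only [← sq, ← pow_succ, ← div_eq_mul_inv] using h2)]
    rw [I_sq]
    field_simp
    ring
  · rw [residueTwo_eq_of_hasResidue
      (by simpa only [← sq, ← pow_succ, ← div_eq_mul_inv] using h3)]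
    rw [I3, hI]
    generalize stieltjesConst 1 = s₁
    field_simp
    ring_nf
    simp only [I_sq]
    ring
  · rw [residueTwo_eq_of_hasResidue
      (by simpa only [← sq, ← pow_succ, ← div_eq_mul_inv] using h4)]
    rw [I4, inv_one, one_mul]
    generalize stieltjesConst 1 = s₁
    generalize stieltjesConst 2 = s₂
    field_simp
    ring_nf
    simp only [I_sq]
    ring

/-! ### Assembly -/

theorem mainTheorem4 (n : ℕ) (hn : 1 ≤ n) (a b : ℝ) (hb : b ≠ 0) :
    -- the general evaluation, no pole on the line of integration
    (a ≠ 1 → a + b ≠ 1 → a + b / 2 ≠ 1 →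
      Integrable (fun v : ℝ => zetaCoshIntegrand n a b v) ∧
      ∫ v : ℝ, zetaCoshIntegrand n a b v = zetaCoshClosedForm n a b) ∧
    -- coalescing poles: the closed form is read as a limit
    (a + b / 2 = 1 →
      Integrable (fun v : ℝ => zetaCoshIntegrand n a b v) ∧
      Tendsto (fun a' : ℝ => zetaCoshClosedForm n a' b) (𝓝[≠] a)
        (𝓝 (∫ v : ℝ, zetaCoshIntegrand n a b v))) ∧
    -- the case of equality: simple pole at `v = 0`, principal value
    (n = 1 → (a = 1 ∨ a + b = 1) →
      (∀ ε : ℝ, 0 < ε →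
        IntegrableOn (fun v : ℝ => zetaCoshIntegrand n a b v) {v : ℝ | ε < |v|}) ∧
      Tendsto (fun ε : ℝ => ∫ v in {v : ℝ | ε < |v|}, zetaCoshIntegrand n a b v) (𝓝[>] 0)
        (𝓝 (zetaCoshClosedForm n a b))) ∧
    -- the residues
    (a + b / 2 ≠ 1 →
      residueOne n a b = 2 * I * b / Real.pi * riemannZeta (a + b / 2) ^ n) ∧
    (∀ A : ℝ, A = Real.pi * (a - 1) / b → Real.cos A ≠ 0 →
      (residueTwo 1 a b = -(I / Real.cos A) ∧ residueThree 1 a b = residueTwo 1 a b) ∧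
      (residueTwo 2 a b =
          I * (-(2 * Real.eulerMascheroniConstant / Real.cos A)
            + Real.pi * Real.sin A / (b * Real.cos A ^ 2)) ∧
        residueThree 2 a b = residueTwo 2 a b) ∧
      (residueTwo 3 a b =
          I * ((3 * stieltjesConst 1 - 3 * Real.eulerMascheroniConstant ^ 2
                + Real.pi ^ 2 / (2 * b ^ 2)) / Real.cos A
            + 3 * Real.sin A * Real.pi * Real.eulerMascheroniConstant / (b * Real.cos A ^ 2)
            - Real.pi ^ 2 / (b ^ 2 * Real.cos A ^ 3)) ∧
        residueThree 3 a b = residueTwo 3 a b) ∧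
      (residueTwo 4 a b =
          I * ((12 * stieltjesConst 1 * Real.eulerMascheroniConstant - 2 * stieltjesConst 2
                - 4 * Real.eulerMascheroniConstant ^ 3
                + 2 * Real.eulerMascheroniConstant * Real.pi ^ 2 / b ^ 2) / Real.cos A
            - Real.pi * Real.sin A * (-36 * Real.eulerMascheroniConstant ^ 2 * b ^ 2
                + 24 * stieltjesConst 1 * b ^ 2 + Real.pi ^ 2) / (6 * b ^ 3 * Real.cos A ^ 2)
            - 4 * Real.pi ^ 2 * Real.eulerMascheroniConstant / (b ^ 2 * Real.cos A ^ 3)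
            + Real.pi ^ 3 * Real.sin A / (b ^ 3 * Real.cos A ^ 4)) ∧
        residueThree 4 a b = residueTwo 4 a b)) ∧
    -- zeta poles outside the closed strip
    (poleWeight a b = 0 →
      Integrable (fun v : ℝ => zetaCoshIntegrand n a b v) ∧
      ∫ v : ℝ, (riemannZeta (a + I * v) ^ n + riemannZeta (a + b - I * v) ^ n) /
          Complex.cosh (Real.pi * v / b) =
        2 * |b| * riemannZeta (a + b / 2) ^ n) ∧
    -- the case `a = -b/2`
    (a = -b / 2 → |b| < 2 →
      Integrable (fun v : ℝ => zetaCoshIntegrand n a b v) ∧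
      ∫ v : ℝ, (riemannZeta (-b / 2 + I * v) ^ n + riemannZeta (b / 2 - I * v) ^ n) /
          Complex.cosh (Real.pi * v / b) =
        2 * |b| * (-1 / 2) ^ n) := by
  refine ⟨fun h₁ h₂ h₃ => integral_zetaCoshIntegrand n hb h₁ h₂ h₃,
    fun h => tendsto_zetaCoshClosedForm n hb h, ?_, residueOne_eq n hb, ?_,
    fun h => integral_zetaCoshIntegrand_of_poleWeight_eq_zero n hb h, ?_⟩
  · rintro rfl (rfl | h)
    · exact tendsto_principalValue_of_eq_one hb
    · exact tendsto_principalValue_of_add_eq_one hb h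
  · rintro A rfl hA
    obtain ⟨h₂, h₃, h₄⟩ := residueTwo_eq hb rfl rfl hA rfl
    exact ⟨⟨residueTwo_one hA, residueThree_eq_residueTwo 1 a hb⟩,
      ⟨h₂, residueThree_eq_residueTwo 2 a hb⟩, ⟨h₃, residueThree_eq_residueTwo 3 a hb⟩,
      ⟨h₄, residueThree_eq_residueTwo 4 a hb⟩⟩
  · rintro rfl hlt
    obtain ⟨hlt₁, hlt₂⟩ := abs_lt.1 hlt
    -- Since |b| < 2, both a = -b/2 and a + b = b/2 are below 1, so the weight vanishes; the
    -- midpoint a + b/2 is 0, where ζ(0) = -1/2.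
    have hw : poleWeight (-b / 2) b = 0 := by
      rw [poleWeight, if_neg, if_neg]
      · rintro (h | h) <;> linarith
      · rintro (⟨-, -, h⟩ | ⟨-, h, -⟩) <;> linarith
    obtain ⟨k₁, k₂⟩ := integral_zetaCoshIntegrand_of_poleWeight_eq_zero n hb hw
    refine ⟨k₁, ?_⟩
    have e₀ : ((-b / 2 : ℝ) + b / 2 : ℂ) = 0 := by push_cast; ring
    rw [e₀, riemannZeta_zero] at k₂
    rw [← k₂]
    refine integral_congr_ae (Eventually.of_forall fun v => ?_)
    have e₁ : ((-b / 2 : ℝ) + b - I * v : ℂ) = b / 2 - I * v := by push_cast; ring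
    have e₂ : ((-b / 2 : ℝ) : ℂ) = -b / 2 := by push_cast; ring
    simp only [zetaCoshIntegrand]
    rw [e₁, e₂]
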